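/- \textbf{Setting.} Terms and bags of the resource calculus are given by $M::=x\mid\lambda x.M\mid MP$ and $P::=1\mid [M]\cdot P\mid[M^!]\cdot P$, up to $\alpha$-equivalence; bags are finite multisets of linear ($M$) and reusable ($M^!$) resources. Sums are finite multisets of expressions, and all constructors but $(\cdot)^!$ commute with sums, while $[(\sum_{i\le k}M_i)^!]\cdot P:=[M_1^!,\dots,M_k^!]\cdot P$ (so $[0^!]\cdot P=P$). $A\{\mathbb S/x\}$ is capture-free substitution of a sum $\mathbb S$. Linear substitution $A\langle N/x\rangle$ is defined by $x\langle N/x\rangle=N$; $y\langle N/x\rangle=0$ for $y\ne x$; $(\lambda y.M)\langle N/x\rangle=\lambda y.M\langle N/x\rangle$ for $y\ne x$ not free in $N$; $(MP)\langle N/x\rangle=M\langle N/x\rangle P+M\,P\langle N/x\rangle$; $1\langle N/x\rangle=0$; $([M]\cdot P)\langle N/x\rangle=[M\langle N/x\rangle]\cdot P+[M]\cdot P\langle N/x\rangle$; $([M^!]\cdot P)\langle N/x\rangle=[M\langle N/x\rangle,M^!]\cdot P+[M^!]\cdot P\langle N/x\rangle$. Put $A\langle N^!/x\rangle:=A\{N+x/x\}$,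 and let $A\langle P/x\rangle$ be obtained by substituting the resources of the bag $P$ one after the other ($x$ not free in $P$). \textbf{Reductions.} The giant step $\to_g$ is the closure of $(\lambda x.M)P\to_g M\langle P/x\rangle\{0/x\}$ under all contexts with exactly one hole (contexts being extended to sums as above), and $M\to_{nd}N$ iff $M\to_g N+\mathbb A$ for some sum $\mathbb A$. The set $\mathcal L(A)$ of leftmost redexes (redex occurrences) is given by $\mathcal L(x)=\mathcal L(1)=\emptyset$, $\mathcal L(\lambda x.M)=\mathcal L(M)$, $\mathcal L([M^!]\cdot P)=\mathcal L(P)$, $\mathcal L([M]\cdot P)=\mathcal L(M)\cup\mathcal L(P)$, and $\mathcal L(MP)=\{MP\}$ if $M$ is an abstraction, otherwise $\mathcal L(M)$ if this is non-empty, otherwise $\mathcal L(P)$. Write $M\to_{lm}N$ if $M\to_{nd}N$ by firing a redex of $\mathcal L(M)$, and $M\to_{\neg lm}N$ if $M\to_{nd}N$ by firing a redex (possibly inside a reusable resource) that is not in $\mathcal L(M)$. A star denotes reflexive-transitive closure. An expression is an outer normal form (onf) if all its redexes lie under the scope of a $(\cdot)^!$. $N$ is a may-outer-normal form (monf) of $M$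 if $M\to_{nd}^*N$ and $N$ is an onf; $M$ is may-outer-normalizable if it has a monf. \textbf{The machine.} $M\Downarrow N$ and the auxiliary $P\Downarrow_bP'$ are the least relations closed under the following rules ($m\ge0$): \begin{itemize} \item if $M\Downarrow M'$ then $\lambda x.M\Downarrow\lambda x.M'$; if $M$ is an onf then $M\Downarrow M$; \item if $P_i\Downarrow_bP_i'$ for $1\le i\le m$ then $xP_1\dots P_m\Downarrow xP_1'\dots P_m'$; \item if $M\{0/x\}$ is a term (not $0$) and $M\{0/x\}P_1\dots P_m\Downarrow M'$ then $(\lambda x.M)1P_1\dots P_m\Downarrow M'$; \item if $M\langle N/x\rangle=M'+\mathbb A$ ($x$ not free in $N$) and $(\lambda x.M')PP_1\dots P_m\Downarrow M''$ then $(\lambda x.M)([N]\cdot P)P_1\dots P_m\Downarrow M''$; \item if $M\{N+x/x\}=M'+\mathbb A$ ($x$ not free in $N$) and $(\lambda x.M')PP_1\dots P_m\Downarrow M''$ then $(\lambda x.M)([N^!]\cdot P)P_1\dots P_m\Downarrow M''$; \item $1\Downarrow_b1$; if $M\Downarrow N$ and $P\Downarrow_bP'$ then $[M]\cdot P\Downarrow_b[N]\cdot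 P'$; if $P\Downarrow_bP'$ then $[M^!]\cdot P\Downarrow_b[M^!]\cdot P'$. \end{itemize} \textbf{Theorem} (Soundness and Completeness of the ND-machine). (i) Soundness: if $M\Downarrow N$, then $M\to_{lm}^*N$ and $N$ is an onf. (ii) Completeness: if $M$ is may-outer-normalizable and $N$ is a monf of $M$, then there is a term $N'$ such that $M\Downarrow N'$, $N'$ is a monf of $M$, and $N'\to_{\neg lm}^*N$. -/

import Mathlib

namespace ResourceCalculus

/-! ### Syntax -/

/-- The two sorts of expressions: terms and bags. -/
inductive Kind
  | term
  | bag

/-- A resource is linear, `M`, or reusable, `M^!`. -/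
inductive Mode
  | linear
  | reusable

/-- Raw expressions, with de Bruijn indices (so that `α`-equivalent expressions are equal):
terms `x | λx.M | M P`, and bags `1 | [M^(!)]·P`, here still listed in some order. -/
inductive PreExpr : Kind → Type
  | var : ℕ → PreExpr .term
  | lam : PreExpr .term → PreExpr .term
  | app : PreExpr .term → PreExpr .bag → PreExpr .term
  | one : PreExpr .bag
  | cons : Mode → PreExpr .term → PreExpr .bag → PreExpr .bag

/-- The congruence on raw expressions generated by exchanging two resources of a bag. -/
inductive PreExpr.Equiv : {s : Kind} → PreExpr s → PreExpr s → Prop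
  | refl {s : Kind} (a : PreExpr s) : PreExpr.Equiv a a
  | symm {s : Kind} {a b : PreExpr s} : PreExpr.Equiv a b → PreExpr.Equiv b a
  | trans {s : Kind} {a b c : PreExpr s} :
      PreExpr.Equiv a b → PreExpr.Equiv b c → PreExpr.Equiv a c
  | lam {m m' : PreExpr .term} : PreExpr.Equiv m m' → PreExpr.Equiv (.lam m) (.lam m')
  | app {m m' : PreExpr .term} {p p' : PreExpr .bag} :
      PreExpr.Equiv m m' → PreExpr.Equiv p p' → PreExpr.Equiv (.app m p) (.app m' p')
  | cons (r : Mode) {m m' : PreExpr .term} {p p' : PreExpr .bag} :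
      PreExpr.Equiv m m' → PreExpr.Equiv p p' → PreExpr.Equiv (.cons r m p) (.cons r m' p')
  | swap (r r' : Mode) (m m' : PreExpr .term) (p : PreExpr .bag) :
      PreExpr.Equiv (.cons r m (.cons r' m' p)) (.cons r' m' (.cons r m p))

instance PreExpr.setoid (s : Kind) : Setoid (PreExpr s) where
  r := PreExpr.Equiv
  iseqv := ⟨PreExpr.Equiv.refl, PreExpr.Equiv.symm, PreExpr.Equiv.trans⟩

/-- Expressions of the resource calculus: at every depth bags are finite multisets. -/
def Expr (s : Kind) : Type := Quotient (PreExpr.setoid s)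

/-- Simple terms. -/
abbrev Term : Type := Expr .term

/-- Bags: finite multisets of resources. -/
abbrev Bag : Type := Expr .bag

/-- Finite formal sums of expressions; the sum `0` is the empty multiset. -/
abbrev FormalSum (s : Kind) : Type := Multiset (Expr s)

/-- The class of a raw expression. -/
def PreExpr.toExpr {s : Kind} (a : PreExpr s) : Expr s := Quotient.mk (PreExpr.setoid s) a

theorem PreExpr.Equiv.toExpr_eq {s : Kind} {a b : PreExpr s} (h : PreExpr.Equiv a b) :
    a.toExpr = b.toExpr :=
  Quotient.sound h

/-- The variable with de Bruijn index `n`. -/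
def Expr.var (n : ℕ) : Term := (PreExpr.var n).toExpr

/-- Abstraction `λx.M`, binding the index `0` of `M`. -/
def Expr.lam : Term → Term :=
  Quotient.lift (fun m => (PreExpr.lam m).toExpr) fun _ _ h => (PreExpr.Equiv.lam h).toExpr_eq

/-- Application `M P` of a term to a bag. -/
def Expr.app : Term → Bag → Term :=
  Quotient.lift₂ (fun m p => (PreExpr.app m p).toExpr)
    fun _ _ _ _ h k => (PreExpr.Equiv.app h k).toExpr_eq

/-- The empty bag `1`. -/
def Expr.one : Bag := PreExpr.one.toExpr

/-- The bag `[M]·P` (mode `linear`) or `[M^!]·P` (mode `reusable`). -/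
def Expr.cons (r : Mode) : Term → Bag → Bag :=
  Quotient.lift₂ (fun m p => (PreExpr.cons r m p).toExpr)
    fun _ _ _ _ h k => (PreExpr.Equiv.cons r h k).toExpr_eq

theorem Expr.cons_swap (r r' : Mode) (M M' : Term) (P : Bag) :
    Expr.cons r M (Expr.cons r' M' P) = Expr.cons r' M' (Expr.cons r M P) := by
  induction M using Quotient.inductionOn
  induction M' using Quotient.inductionOn
  induction P using Quotient.inductionOn
  exact (PreExpr.Equiv.swap r r' _ _ _).toExpr_eq

instance : LeftCommutative (Expr.cons .reusable) := ⟨Expr.cons_swap .reusable .reusable⟩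

/-- `[(M₁ + ⋯ + M_k)^!]·P = [M₁^!, …, M_k^!]·P`; in particular `[0^!]·P = P`. -/
def bangSum (S : FormalSum .term) (P : Bag) : Bag := S.foldr (Expr.cons .reusable) P

/-- `M P₁ … P_m`. -/
def apps (M : Term) (Ps : List Bag) : Term := Ps.foldl Expr.app M

/-! ### Renaming -/

/-- A renaming of indices, under one binder. -/
def liftRen (ρ : ℕ → ℕ) : ℕ → ℕ
  | 0 => 0
  | n + 1 => ρ n + 1

/-- Renaming of the free indices. -/
def PreExpr.rename : {s : Kind} → (ℕ → ℕ) → PreExpr s → PreExpr s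
  | _, ρ, .var n => .var (ρ n)
  | _, ρ, .lam m => .lam (m.rename (liftRen ρ))
  | _, ρ, .app m p => .app (m.rename ρ) (p.rename ρ)
  | _, _, .one => .one
  | _, ρ, .cons r m p => .cons r (m.rename ρ) (p.rename ρ)

theorem PreExpr.Equiv.rename {s : Kind} {a b : PreExpr s} (h : PreExpr.Equiv a b) :
    ∀ ρ : ℕ → ℕ, PreExpr.Equiv (a.rename ρ) (b.rename ρ) := by
  induction h with
  | refl a => exact fun ρ => .refl _
  | symm _ ih => exact fun ρ => (ih ρ).symm
  | trans _ _ ih ih' => exact fun ρ => (ih ρ).trans (ih' ρ)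
  | lam _ ih => exact fun ρ => .lam (ih _)
  | app _ _ ih ih' => exact fun ρ => .app (ih ρ) (ih' ρ)
  | cons r _ _ ih ih' => exact fun ρ => .cons r (ih ρ) (ih' ρ)
  | swap r r' m m' p => exact fun ρ => .swap r r' _ _ _

/-- Renaming of the free indices of an expression. -/
def Expr.rename {s : Kind} (ρ : ℕ → ℕ) : Expr s → Expr s :=
  Quotient.lift (fun a => (a.rename ρ).toExpr) fun _ _ h => (PreExpr.Equiv.rename h ρ).toExpr_eq

/-- The expression seen from under one more binder: index `0` does not occur in `A.shift`. -/
def Expr.shift {s : Kind} (A : Expr s) : Expr s := A.rename Nat.succ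

/-! ### Substitutions -/

/-- A simultaneous substitution of sums for indices, under one binder. -/
def liftSub (σ : ℕ → FormalSum .term) : ℕ → FormalSum .term
  | 0 => {Expr.var 0}
  | n + 1 => (σ n).map Expr.shift

/-- Capture-free substitution of sums of terms for the free indices. All constructors but `(·)^!`
commute with sums. -/
def PreExpr.subst : {s : Kind} → (ℕ → FormalSum .term) → PreExpr s → FormalSum s
  | _, σ, .var n => σ n
  | _, σ, .lam m => (m.subst (liftSub σ)).map Expr.lam
  | _, σ, .app m p => (m.subst σ).bind fun M => (p.subst σ).map fun P => Expr.app M P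
  | _, _, .one => {Expr.one}
  | _, σ, .cons .linear m p =>
      (m.subst σ).bind fun M => (p.subst σ).map fun P => Expr.cons .linear M P
  | _, σ, .cons .reusable m p => (p.subst σ).map fun P => bangSum (m.subst σ) P

/-- Linear substitution of the term `N` for the index `x`. -/
def PreExpr.linSubst : {s : Kind} → ℕ → Term → PreExpr s → FormalSum s
  | _, x, N, .var y => if y = x then {N} else 0
  | _, x, N, .lam m => (m.linSubst (x + 1) N.shift).map Expr.lam
  | _, x, N, .app m p =>
      ((m.linSubst x N).map fun M => Expr.app M p.toExpr) +
        (p.linSubst x N).map fun P => Expr.app m.toExpr P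
  | _, _, _, .one => 0
  | _, x, N, .cons .linear m p =>
      ((m.linSubst x N).map fun M => Expr.cons .linear M p.toExpr) +
        (p.linSubst x N).map fun P => Expr.cons .linear m.toExpr P
  | _, x, N, .cons .reusable m p =>
      ((m.linSubst x N).map fun M =>
          Expr.cons .linear M (Expr.cons .reusable m.toExpr p.toExpr)) +
        (p.linSubst x N).map fun P => Expr.cons .reusable m.toExpr P

theorem bangSum_cons (r : Mode) (S : FormalSum .term) (M : Term) (P : Bag) :
    bangSum S (Expr.cons r M P) = Expr.cons r M (bangSum S P) := by
  unfold bangSum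
  induction S using Multiset.induction_on with
  | empty => simp
  | cons a S ih => rw [Multiset.foldr_cons, Multiset.foldr_cons, ih, Expr.cons_swap]

theorem bangSum_comm (S T : FormalSum .term) (P : Bag) :
    bangSum S (bangSum T P) = bangSum T (bangSum S P) := by
  induction T using Multiset.induction_on with
  | empty => simp [bangSum]
  | cons a T ih =>
    have h : ∀ Q, bangSum (a ::ₘ T) Q = Expr.cons .reusable a (bangSum T Q) := fun Q => by
      simp [bangSum]
    rw [h, h, bangSum_cons, ih]

theorem PreExpr.Equiv.subst {s : Kind} {a b : PreExpr s} (h : PreExpr.Equiv a b) :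
    ∀ σ : ℕ → FormalSum .term, a.subst σ = b.subst σ := by
  induction h with
  | refl a => exact fun σ => rfl
  | symm _ ih => exact fun σ => (ih σ).symm
  | trans _ _ ih ih' => exact fun σ => (ih σ).trans (ih' σ)
  | lam _ ih => intro σ; simp only [PreExpr.subst, ih]
  | app _ _ ih ih' => intro σ; simp only [PreExpr.subst, ih, ih']
  | cons r _ _ ih ih' => intro σ; cases r <;> simp only [PreExpr.subst, ih, ih']
  | swap r r' m m' p =>
    intro σ
    cases r <;> cases r' <;>
      simp only [PreExpr.subst, Multiset.map_bind, Multiset.map_map, Function.comp_def,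
        bangSum_cons]
    · rw [Multiset.bind_bind]
      simp only [Expr.cons_swap]
    · exact Multiset.map_congr rfl fun P _ => bangSum_comm _ _ _

theorem PreExpr.Equiv.linSubst {s : Kind} {a b : PreExpr s} (h : PreExpr.Equiv a b) :
    ∀ (x : ℕ) (N : Term), a.linSubst x N = b.linSubst x N := by
  induction h with
  | refl a => exact fun x N => rfl
  | symm _ ih => exact fun x N => (ih x N).symm
  | trans _ _ ih ih' => exact fun x N => (ih x N).trans (ih' x N)
  | lam _ ih => intro x N; simp only [PreExpr.linSubst, ih]
  | app h h' ih ih' =>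
    intro x N; simp only [PreExpr.linSubst, ih, ih', h.toExpr_eq, h'.toExpr_eq]
  | cons r h h' ih ih' =>
    intro x N; cases r <;> simp only [PreExpr.linSubst, ih, ih', h.toExpr_eq, h'.toExpr_eq]
  | swap r r' m m' p =>
    intro x N
    have e : ∀ (r : Mode) (m : PreExpr .term) (p : PreExpr .bag),
        (PreExpr.cons r m p).toExpr = Expr.cons r m.toExpr p.toExpr := fun _ _ _ => rfl
    cases r <;> cases r' <;>
      simp only [PreExpr.linSubst, Multiset.map_add, Multiset.map_map, Function.comp_def, e] <;>
      rw [add_left_comm] <;>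
      refine congrArg₂ _ (Multiset.map_congr rfl fun M _ => ?_)
        (congrArg₂ _ (Multiset.map_congr rfl fun M _ => ?_)
          (Multiset.map_congr rfl fun M _ => ?_)) <;>
      grind [Expr.cons_swap]

/-- Capture-free substitution of sums of terms for the free indices of an expression. -/
def Expr.subst {s : Kind} (σ : ℕ → FormalSum .term) : Expr s → FormalSum s :=
  Quotient.lift (fun a => a.subst σ) fun _ _ h => PreExpr.Equiv.subst h σ

/-- Linear substitution `A⟨N/x⟩`. -/
def Expr.linSubst {s : Kind} (A : Expr s) (x : ℕ) (N : Term) : FormalSum s :=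
  Quotient.lift (fun a => a.linSubst x N) (fun _ _ h => PreExpr.Equiv.linSubst h x N) A

/-- Partial substitution `A{N + x / x}`. -/
def Expr.partialSubst {s : Kind} (A : Expr s) (x : ℕ) (N : Term) : FormalSum s :=
  A.subst fun y => if y = x then {N} + {Expr.var x} else {Expr.var y}

/-- Resource substitution: `A⟨N/x⟩` for a linear resource, `A{N + x / x}` for a reusable one. -/
def Expr.resSubst {s : Kind} (A : Expr s) (x : ℕ) (r : Mode) (N : Term) : FormalSum s :=
  match r with
  | .linear => Expr.linSubst A x N
  | .reusable => Expr.partialSubst A x N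

/-- Bag substitution: `BagSubst x S P T` says `S⟨P/x⟩ = T`, where the resources of `P` are
substituted one after the other (linearly in the sum `S`), in some order. -/
inductive BagSubst {s : Kind} (x : ℕ) : FormalSum s → Bag → FormalSum s → Prop
  | one (S : FormalSum s) : BagSubst x S Expr.one S
  | cons (r : Mode) (N : Term) (P : Bag) (S T : FormalSum s) :
      BagSubst x (S.bind fun A => Expr.resSubst A x r N) P T → BagSubst x S (Expr.cons r N P) T

/-- `M{0/x}` for the bound variable `x` (index `0`) of `λx.M`, as an expression living outside
of that binder. -/
def Expr.zeroSubst {s : Kind} : Expr s → FormalSum s :=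
  Expr.subst fun
    | 0 => 0
    | n + 1 => {Expr.var n}

/-! ### Contexts and redexes -/

/-- Simple contexts (one occurrence of the hole). As bags are unordered, a simple bag context is
`[C^(!)]·P` with `C` a simple term context. -/
inductive Ctx : Kind → Type
  | hole : Ctx .term
  | lam : Ctx .term → Ctx .term
  | appL : Ctx .term → Bag → Ctx .term
  | appR : Term → Ctx .bag → Ctx .term
  | bag : Mode → Ctx .term → Bag → Ctx .bag

/-- `C[M]`, with possible capture of variables. -/
def Ctx.fill : {s : Kind} → Ctx s → Term → Expr s
  | _, .hole, M => M
  | _, .lam C, M => Expr.lam (C.fill M)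
  | _, .appL C P, M => Expr.app (C.fill M) P
  | _, .appR L C, M => Expr.app L (C.fill M)
  | _, .bag r C P, M => Expr.cons r (C.fill M) P

/-- `C[S]` for a sum `S` of terms: all constructors but `(·)^!` commute with sums. -/
def Ctx.fillSum : {s : Kind} → Ctx s → FormalSum .term → FormalSum s
  | _, .hole, S => S
  | _, .lam C, S => (C.fillSum S).map Expr.lam
  | _, .appL C P, S => (C.fillSum S).map fun M => Expr.app M P
  | _, .appR L C, S => (C.fillSum S).map fun P => Expr.app L P
  | _, .bag .linear C P, S => (C.fillSum S).map fun M => Expr.cons .linear M P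
  | _, .bag .reusable C P, S => {bangSum (C.fillSum S) P}

/-- The hole is not under the scope of a `(·)^!`. -/
def Ctx.IsLinear : {s : Kind} → Ctx s → Prop
  | _, .hole => True
  | _, .lam C => C.IsLinear
  | _, .appL C _ => C.IsLinear
  | _, .appR _ C => C.IsLinear
  | _, .bag .linear C _ => C.IsLinear
  | _, .bag .reusable _ _ => False

/-- The context `[M^(!)]·C`, for a bag context `C`. -/
def Ctx.consTail (r : Mode) (M : Term) : Ctx .bag → Ctx .bag
  | .bag r' C P => .bag r' C (Expr.cons r M P)

/-- A redex is a term `(λx.M)P`. -/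
def IsRedex (R : Term) : Prop := ∃ (M : Term) (P : Bag), R = Expr.app (Expr.lam M) P

/-- Occurrences of subterms: the occurrence `(C, R)` is the subterm `R` of `C[R]` that stands at
the hole of `C`. -/
abbrev Occ (s : Kind) : Type := Ctx s × Term

/-- The raw expression is an abstraction. -/
def PreExpr.IsLam : {s : Kind} → PreExpr s → Prop
  | _, .lam _ => True
  | _, _ => False

open Classical in
/-- The leftmost redexes of a raw expression. -/
def PreExpr.leftmost : {s : Kind} → PreExpr s → Set (Occ s)
  | _, .var _ => ∅
  | _, .lam m => (fun o : Occ .term => (Ctx.lam o.1, o.2)) '' m.leftmost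
  | _, .app m p =>
      if m.IsLam then {(Ctx.hole, (PreExpr.app m p).toExpr)}
      else if m.leftmost ≠ ∅ then
        (fun o : Occ .term => (Ctx.appL o.1 p.toExpr, o.2)) '' m.leftmost
      else (fun o : Occ .bag => (Ctx.appR m.toExpr o.1, o.2)) '' p.leftmost
  | _, .one => ∅
  | _, .cons .reusable m p =>
      (fun o : Occ .bag => (o.1.consTail .reusable m.toExpr, o.2)) '' p.leftmost
  | _, .cons .linear m p =>
      (fun o : Occ .term => (Ctx.bag .linear o.1 p.toExpr, o.2)) '' m.leftmost ∪
        (fun o : Occ .bag => (o.1.consTail .linear m.toExpr, o.2)) '' p.leftmost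

theorem PreExpr.Equiv.isLam {s : Kind} {a b : PreExpr s} (h : PreExpr.Equiv a b) :
    a.IsLam ↔ b.IsLam := by
  induction h with
  | symm _ ih => exact ih.symm
  | trans _ _ ih ih' => exact ih.trans ih'
  | _ => simp [PreExpr.IsLam]

theorem Ctx.consTail_bag (r r' : Mode) (M : Term) (C : Ctx .term) (P : Bag) :
    (Ctx.bag r' C P).consTail r M = Ctx.bag r' C (Expr.cons r M P) := rfl

theorem Ctx.consTail_swap (r r' : Mode) (M M' : Term) (C : Ctx .bag) :
    (C.consTail r' M').consTail r M = (C.consTail r M).consTail r' M' := by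
  cases C with
  | bag q C P => simp only [Ctx.consTail, Expr.cons_swap r r']

theorem PreExpr.Equiv.leftmost {s : Kind} {a b : PreExpr s} (h : PreExpr.Equiv a b) :
    a.leftmost = b.leftmost := by
  induction h with
  | refl a => rfl
  | symm _ ih => exact ih.symm
  | trans _ _ ih ih' => exact ih.trans ih'
  | lam _ ih => simp only [PreExpr.leftmost, ih]
  | app h h' ih ih' =>
    simp only [PreExpr.leftmost, ih, ih', h.toExpr_eq, h'.toExpr_eq,
      (PreExpr.Equiv.app h h').toExpr_eq]
    classical exact if_congr h.isLam rfl rfl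
  | cons r h h' ih ih' =>
    cases r <;> simp only [PreExpr.leftmost, ih, ih', h.toExpr_eq, h'.toExpr_eq]
  | swap r r' m m' p =>
    have e : ∀ (r : Mode) (m : PreExpr .term) (p : PreExpr .bag),
        (PreExpr.cons r m p).toExpr = Expr.cons r m.toExpr p.toExpr := fun _ _ _ => rfl
    cases r <;> cases r' <;>
      simp only [PreExpr.leftmost, Set.image_union, Set.image_image, e, Ctx.consTail_bag]
    · rw [Set.union_left_comm]
      simp only [Ctx.consTail_swap .linear .linear m.toExpr m'.toExpr]
    · simp only [Ctx.consTail_swap .linear .reusable m.toExpr m'.toExpr]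
    · simp only [Ctx.consTail_swap .reusable .linear m.toExpr m'.toExpr]
    · simp only [Ctx.consTail_swap .reusable .reusable m.toExpr m'.toExpr]

/-- The set `𝓛(A)` of leftmost redexes of a term or bag `A`. -/
def Expr.leftmost {s : Kind} : Expr s → Set (Occ s) :=
  Quotient.lift PreExpr.leftmost fun _ _ h => PreExpr.Equiv.leftmost h

/-! ### Reductions -/

/-- The giant step at the root, `(λx.M)P → M⟨P/x⟩{0/x}`. -/
def RootGiant (R : Term) (T : FormalSum .term) : Prop :=
  ∃ (M : Term) (P : Bag) (S : FormalSum .term),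
    R = Expr.app (Expr.lam M) P ∧ BagSubst 0 {M} P.shift S ∧ T = S.bind Expr.zeroSubst

/-- `A →g T` by firing the redex occurrence `o` of `A` (simple context closure). -/
def GiantAt {s : Kind} (o : Occ s) (A : Expr s) (T : FormalSum s) : Prop :=
  A = o.1.fill o.2 ∧ ∃ S : FormalSum .term, RootGiant o.2 S ∧ T = o.1.fillSum S

/-- `A →nd B` by firing the redex occurrence `o`: the result of the giant step is `B + 𝔸`. -/
def NDStepAt {s : Kind} (o : Occ s) (A B : Expr s) : Prop :=
  ∃ (T : FormalSum s) (U : FormalSum s), GiantAt o A T ∧ T = {B} + U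

/-- The non-deterministic reduction `A →nd B`. -/
def NDStep {s : Kind} (A B : Expr s) : Prop := ∃ o : Occ s, NDStepAt o A B

/-- `A →lm B`: an outer non-deterministic step that fires a leftmost redex. -/
def LmStep {s : Kind} (A B : Expr s) : Prop :=
  ∃ o : Occ s, NDStepAt o A B ∧ o.1.IsLinear ∧ o ∈ A.leftmost

/-- `A →¬lm B`: a non-deterministic step that fires a redex (under a `(·)^!` or not) which is not
leftmost. -/
def NonLmStep {s : Kind} (A B : Expr s) : Prop :=
  ∃ o : Occ s, NDStepAt o A B ∧ o ∉ A.leftmost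

/-- Outer normal forms: no redex but under the scope of a `(·)^!`. -/
def IsOnf {s : Kind} (A : Expr s) : Prop :=
  ∀ (C : Ctx s) (R : Term), C.IsLinear → IsRedex R → A ≠ C.fill R

/-- `N` is a may-outer-normal form of `M`. -/
def IsMonf (N M : Term) : Prop := Relation.ReflTransGen NDStep M N ∧ IsOnf N

/-- `M` is may-outer-normalizable. -/
def MayOuterNormalizable (M : Term) : Prop := ∃ N : Term, IsMonf N M

/-! ### The machine -/

mutual

/-- The statements `M ⇓ N` proved by the `ND`-machine. In `beta` and `bangBeta` one addend `M'` of
the substitution `M⟨N/x⟩ = M' + 𝔸`, resp. `M{N + x / x} = M' + 𝔸`, is chosen. -/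
inductive NDMachine : Term → Term → Prop
  | lam (M M' : Term) : NDMachine M M' → NDMachine (Expr.lam M) (Expr.lam M')
  | endRule (M : Term) : IsOnf M → NDMachine M M
  /-- Here `Qs` lists the pairs `(P_i, P'_i)`. -/
  | head (x : ℕ) (Qs : List (Bag × Bag)) : (∀ q ∈ Qs, BMachine q.1 q.2) →
      NDMachine (apps (Expr.var x) (Qs.map Prod.fst)) (apps (Expr.var x) (Qs.map Prod.snd))
  | zero (M M₀ M' : Term) (Ps : List Bag) : M.zeroSubst = {M₀} →
      NDMachine (apps M₀ Ps) M' →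
      NDMachine (apps (Expr.app (Expr.lam M) Expr.one) Ps) M'
  | beta (M N M' M'' : Term) (P : Bag) (Ps : List Bag) (U : FormalSum .term) :
      Expr.linSubst M 0 N.shift = {M'} + U →
      NDMachine (apps (Expr.app (Expr.lam M') P) Ps) M'' →
      NDMachine (apps (Expr.app (Expr.lam M) (Expr.cons .linear N P)) Ps) M''
  | bangBeta (M N M' M'' : Term) (P : Bag) (Ps : List Bag) (U : FormalSum .term) :
      Expr.partialSubst M 0 N.shift = {M'} + U →
      NDMachine (apps (Expr.app (Expr.lam M') P) Ps) M'' →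
      NDMachine (apps (Expr.app (Expr.lam M) (Expr.cons .reusable N P)) Ps) M''

/-- The statements `P ⇓b P'` proved by the auxiliary `B`-machine. -/
inductive BMachine : Bag → Bag → Prop
  | one : BMachine Expr.one Expr.one
  | lin (M N : Term) (P P' : Bag) : NDMachine M N → BMachine P P' →
      BMachine (Expr.cons .linear M P) (Expr.cons .linear N P')
  | bang (M : Term) (P P' : Bag) : BMachine P P' →
      BMachine (Expr.cons .reusable M P) (Expr.cons .reusable M P')

end

end ResourceCalculus

-- The machine performs a giant step one resource at a time, so a run of it is a sequence of
-- leftmost giant steps cut into pieces. Soundness glues the pieces together (`lmStep_star_redex`):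
-- an intermediate state `(λx.M')P P₁…P_m` is not an onf and its only leftmost redex is the head
-- one, so its leftmost reduction begins by firing that redex, and this step absorbs the resource
-- that was substituted just before.
--
-- Completeness is a standardization theorem. In a `Standard` reduction weak head steps come first
-- and the immediate subexpressions are treated afterwards, recursively. Every `→nd`-reduction
-- yields a standard one, because a giant step appended to a standard reduction can be absorbed
-- (`Standard.giantStep`). When the appended step fires a root redex, each addend of its result must
-- have an ancestor in the giant step performed earlier (`Standard.giantS`). This rests on pulling
-- weak head steps back along ordinary and linear substitution (`WeakHead.subst`,
-- `WeakHead.linSubst`), hence on the commutation of giant steps with both (`substS_giantS`,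
-- `dsubstS_giantS`). These commutations are differential calculus: linear substitution is the
-- derivative `dsubst` of substitution at the identity, and the chain rule and the symmetry of the
-- second derivative give all the laws needed, including the irrelevance of the order in which the
-- resources of a bag are substituted.
--
-- Reusable resources need care. A step inside `M^!` replaces it by as many reusable resources as
-- the result has addends, possibly none. Hence a whole group `U` of reusable resources is reduced
-- to a group `T` as a sum; in addition each member of `T` must be reached by a standard reduction
-- from a member of `U`, since it may be copied to a linear position later.
--
-- A standard reduction to an onf is finally read as a machine run (`Standard.complete`), with the
-- steps inside reusable resources postponed to the end. The machine's result is an onf by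
-- soundness; onfs are stable under `→nd` and have no leftmost redexes, so all postponed steps are
-- `→¬lm`.

namespace ResourceCalculus

/-! ### Structure of expressions -/

/-- The outermost constructor of an expression, bags being seen as multisets of resources. -/
inductive View
  | var (n : ℕ)
  | lam (M : Term)
  | app (M : Term) (P : Bag)
  | bag (R : Multiset (Mode × Term))

/-- The resources of a bag. -/
def PreExpr.resources : {s : Kind} → PreExpr s → Multiset (Mode × Term)
  | _, .var _ => 0
  | _, .lam _ => 0
  | _, .app _ _ => 0
  | _, .one => 0
  | _, .cons r m p => (r, m.toExpr) ::ₘ p.resources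

/-- The outermost constructor of a raw expression. -/
def PreExpr.view : {s : Kind} → PreExpr s → View
  | _, .var n => .var n
  | _, .lam m => .lam m.toExpr
  | _, .app m p => .app m.toExpr p.toExpr
  | _, .one => .bag 0
  | _, .cons r m p => .bag ((r, m.toExpr) ::ₘ p.resources)

theorem PreExpr.Equiv.resources {s : Kind} {a b : PreExpr s} (h : PreExpr.Equiv a b) :
    a.resources = b.resources := by
  induction h with
  | refl a => rfl
  | symm _ ih => exact ih.symm
  | trans _ _ ih ih' => exact ih.trans ih'
  | lam _ _ => rfl
  | app _ _ _ _ => rfl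
  | cons r h _ _ ih => simp only [PreExpr.resources, h.toExpr_eq, ih]
  | swap r r' m m' p => exact Multiset.cons_swap _ _ _

theorem PreExpr.Equiv.view {s : Kind} {a b : PreExpr s} (h : PreExpr.Equiv a b) :
    a.view = b.view := by
  induction h with
  | refl a => rfl
  | symm _ ih => exact ih.symm
  | trans _ _ ih ih' => exact ih.trans ih'
  | lam h _ => simp only [PreExpr.view, h.toExpr_eq]
  | app h h' _ _ => simp only [PreExpr.view, h.toExpr_eq, h'.toExpr_eq]
  | cons r h h' _ _ => simp only [PreExpr.view, h.toExpr_eq, h'.resources]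
  | swap r r' m m' p => simp only [PreExpr.view, PreExpr.resources, Multiset.cons_swap]

/-- The resources of a bag. -/
def Expr.resources {s : Kind} : Expr s → Multiset (Mode × Term) :=
  Quotient.lift PreExpr.resources fun _ _ h => PreExpr.Equiv.resources h

/-- The outermost constructor of an expression. -/
def Expr.view {s : Kind} : Expr s → View :=
  Quotient.lift PreExpr.view fun _ _ h => PreExpr.Equiv.view h

namespace Expr

theorem induction {motive : ∀ s : Kind, Expr s → Prop}
    (var : ∀ n, motive .term (Expr.var n))
    (lam : ∀ M, motive .term M → motive .term (Expr.lam M))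
    (app : ∀ M P, motive .term M → motive .bag P → motive .term (Expr.app M P))
    (one : motive .bag Expr.one)
    (cons : ∀ r M P, motive .term M → motive .bag P → motive .bag (Expr.cons r M P)) :
    ∀ {s : Kind} (A : Expr s), motive s A := by
  intro s A
  induction A using Quotient.inductionOn with
  | h a =>
    induction a with
    | var n => exact var n
    | lam m ih => exact lam _ ih
    | app m p ih ih' => exact app _ _ ih ih'
    | one => exact one
    | cons r m p ih ih' => exact cons r _ _ ih ih'

theorem bagInduction {motive : Bag → Prop} (one : motive Expr.one)
    (cons : ∀ r M P, motive P → motive (Expr.cons r M P)) (P : Bag) : motive P :=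
  Expr.induction (motive := fun s => match s with
    | .term => fun _ => True
    | .bag => motive) (fun _ => trivial) (fun _ _ => trivial) (fun _ _ _ _ => trivial) one
    (fun r M P _ h => cons r M P h) P

@[simp] theorem view_var (n : ℕ) : (var n).view = .var n := rfl

@[simp] theorem view_lam (M : Term) : (lam M).view = .lam M := by
  induction M using Quotient.inductionOn; rfl

@[simp] theorem view_app (M : Term) (P : Bag) : (app M P).view = .app M P := by
  induction M using Quotient.inductionOn; induction P using Quotient.inductionOn; rfl

@[simp] theorem resources_one : one.resources = 0 := rfl

@[simp] theorem resources_cons (r : Mode) (M : Term) (P : Bag) :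
    (cons r M P).resources = (r, M) ::ₘ P.resources := by
  induction M using Quotient.inductionOn; induction P using Quotient.inductionOn; rfl

@[simp] theorem lam_inj {M M' : Term} : lam M = lam M' ↔ M = M' :=
  ⟨fun h => by simpa using congrArg view h, congrArg lam⟩

@[simp] theorem app_inj {M M' : Term} {P P' : Bag} : app M P = app M' P' ↔ M = M' ∧ P = P' :=
  ⟨fun h => by simpa using congrArg view h, fun h => by rw [h.1, h.2]⟩

@[simp] theorem var_ne_lam {n : ℕ} {M : Term} : var n ≠ lam M :=
  fun h => by simpa using congrArg view h

@[simp] theorem var_ne_app {n : ℕ} {M : Term} {P : Bag} : var n ≠ app M P :=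
  fun h => by simpa using congrArg view h

@[simp] theorem lam_ne_app {L M : Term} {P : Bag} : lam L ≠ app M P :=
  fun h => by simpa using congrArg view h

@[simp] theorem lam_ne_var {n : ℕ} {M : Term} : lam M ≠ var n := var_ne_lam.symm

@[simp] theorem app_ne_var {n : ℕ} {M : Term} {P : Bag} : app M P ≠ var n := var_ne_app.symm

@[simp] theorem app_ne_lam {L M : Term} {P : Bag} : app M P ≠ lam L := lam_ne_app.symm

/-- The bag with given resources. -/
def ofResources (R : Multiset (Mode × Term)) : Bag :=
  haveI : LeftCommutative fun (a : Mode × Term) (P : Bag) => cons a.1 a.2 P :=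
    ⟨fun a b P => cons_swap a.1 b.1 a.2 b.2 P⟩
  R.foldr (fun a P => cons a.1 a.2 P) one

@[simp] theorem ofResources_cons (a : Mode × Term) (R : Multiset (Mode × Term)) :
    ofResources (a ::ₘ R) = cons a.1 a.2 (ofResources R) := by
  simp [ofResources]

@[simp] theorem ofResources_resources (P : Bag) : ofResources P.resources = P := by
  induction P using bagInduction with
  | one => simp [ofResources]
  | cons r M P ih => simp [ih]

@[simp] theorem resources_ofResources (R : Multiset (Mode × Term)) :
    (ofResources R).resources = R := by
  induction R using Multiset.induction_on with
  | empty => simp [ofResources]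
  | cons a R ih => simp [ih]

theorem resources_injective {P Q : Bag} (h : P.resources = Q.resources) : P = Q := by
  rw [← ofResources_resources P, h, ofResources_resources]

@[simp] theorem one_ne_cons {r : Mode} {M : Term} {P : Bag} : one ≠ cons r M P :=
  fun h => by simpa using congrArg resources h

@[simp] theorem cons_ne_one {r : Mode} {M : Term} {P : Bag} : cons r M P ≠ one :=
  one_ne_cons.symm

/-- A bag is determined by its multiset of resources, so this is the corresponding fact on
multisets. It replaces injectivity of `cons`, which fails for unordered bags. -/
theorem cons_eq_cons {r r' : Mode} {M M' : Term} {P P' : Bag} :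
    cons r M P = cons r' M' P' ↔ (r = r' ∧ M = M' ∧ P = P') ∨
      ∃ Q, P = cons r' M' Q ∧ P' = cons r M Q := by
  constructor
  · intro h
    have h' := congrArg resources h
    simp only [resources_cons, Multiset.cons_eq_cons] at h'
    rcases h' with ⟨h₁, h₂⟩ | ⟨-, R, h₁, h₂⟩
    · simp only [Prod.mk.injEq] at h₁
      exact .inl ⟨h₁.1, h₁.2, resources_injective h₂⟩
    · refine .inr ⟨ofResources R, resources_injective ?_, resources_injective ?_⟩ <;> simpa
  · rintro (⟨rfl, rfl, rfl⟩ | ⟨Q, rfl, rfl⟩)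
    · rfl
    · exact cons_swap _ _ _ _ _

end Expr

-- Groups of reusable resources

@[simp] theorem bangSum_zero (P : Bag) : bangSum 0 P = P := by simp [bangSum]

@[simp] theorem bangSum_cons_left (M : Term) (S : FormalSum .term) (P : Bag) :
    bangSum (M ::ₘ S) P = Expr.cons .reusable M (bangSum S P) := by simp [bangSum]

@[simp] theorem bangSum_singleton (M : Term) (P : Bag) :
    bangSum {M} P = Expr.cons .reusable M P := by simp [bangSum]

theorem bangSum_add (S T : FormalSum .term) (P : Bag) :
    bangSum (S + T) P = bangSum S (bangSum T P) := by
  induction S using Multiset.induction_on with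
  | empty => simp
  | cons a S ih => simp [ih]

/-- All members of the group `S` are reusable, so a linear resource can only come from `P`. -/
theorem bangSum_eq_linear {S : FormalSum .term} {P Q : Bag} {M : Term} :
    bangSum S P = Expr.cons .linear M Q →
      ∃ Q', P = Expr.cons .linear M Q' ∧ Q = bangSum S Q' := by
  induction S using Multiset.induction_on generalizing Q with
  | empty => exact fun h => ⟨Q, by simpa using h, by simp⟩
  | cons a S ih =>
    intro h
    rw [bangSum_cons_left, Expr.cons_eq_cons] at h
    rcases h with ⟨h, -⟩ | ⟨Q₁, h₁, rfl⟩
    · cases h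
    · obtain ⟨Q', rfl, rfl⟩ := ih h₁
      exact ⟨Q', rfl, by simp⟩

theorem bangSum_eq_reusable {S : FormalSum .term} {P Q : Bag} {M : Term} :
    bangSum S P = Expr.cons .reusable M Q →
      (∃ S', S = M ::ₘ S' ∧ Q = bangSum S' P) ∨
      ∃ Q', P = Expr.cons .reusable M Q' ∧ Q = bangSum S Q' := by
  induction S using Multiset.induction_on generalizing Q with
  | empty => exact fun h => .inr ⟨Q, by simpa using h, by simp⟩
  | cons a S ih =>
    intro h
    rw [bangSum_cons_left, Expr.cons_eq_cons] at h
    rcases h with ⟨-, rfl, rfl⟩ | ⟨Q₁, h₁, rfl⟩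
    · exact .inl ⟨S, rfl, rfl⟩
    · rcases ih h₁ with ⟨S', rfl, rfl⟩ | ⟨Q', rfl, rfl⟩
      · exact .inl ⟨a ::ₘ S', Multiset.cons_swap _ _ _, by simp⟩
      · exact .inr ⟨Q', rfl, by simp⟩

/-! ### Constructors on sums -/

/-- Abstraction of a sum. -/
def lamS (S : FormalSum .term) : FormalSum .term := S.map Expr.lam

/-- Application of sums. -/
def appS (S : FormalSum .term) (T : FormalSum .bag) : FormalSum .term :=
  S.bind fun M => T.map fun P => Expr.app M P

/-- The sum of bags `[S]·T`. -/
def consS (S : FormalSum .term) (T : FormalSum .bag) : FormalSum .bag :=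
  S.bind fun M => T.map fun P => Expr.cons .linear M P

/-- The sum of bags `[S^!]·T`. -/
def bangS (S : FormalSum .term) (T : FormalSum .bag) : FormalSum .bag :=
  T.map fun P => bangSum S P

section Sums

variable {α : Type*} (S S' : FormalSum .term) (T T' : FormalSum .bag)

@[simp] theorem lamS_zero : lamS 0 = 0 := rfl
@[simp] theorem lamS_singleton (M : Term) : lamS {M} = {Expr.lam M} := rfl
theorem lamS_add : lamS (S + S') = lamS S + lamS S' := Multiset.map_add _ _ _
theorem lamS_bind (U : Multiset α) (f : α → FormalSum .term) :
    lamS (U.bind f) = U.bind fun a => lamS (f a) := Multiset.map_bind _ _ _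
theorem mem_lamS {M : Term} : M ∈ lamS S ↔ ∃ M₀ ∈ S, Expr.lam M₀ = M := Multiset.mem_map

@[simp] theorem appS_zero_left : appS 0 T = 0 := rfl
@[simp] theorem appS_zero_right : appS S 0 = 0 := by simp [appS]
@[simp] theorem appS_singleton (M : Term) (P : Bag) : appS {M} {P} = {Expr.app M P} := by
  simp [appS]
theorem appS_add_left : appS (S + S') T = appS S T + appS S' T := Multiset.add_bind _ _ _
theorem appS_add_right : appS S (T + T') = appS S T + appS S T' := by
  simp [appS, Multiset.bind_add]
theorem appS_bind_left (U : Multiset α) (f : α → FormalSum .term) :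
    appS (U.bind f) T = U.bind fun a => appS (f a) T := Multiset.bind_assoc
theorem appS_bind_right (U : Multiset α) (f : α → FormalSum .bag) :
    appS S (U.bind f) = U.bind fun a => appS S (f a) := by
  simp only [appS, Multiset.map_bind]; exact Multiset.bind_bind _ _
theorem appS_singleton_left (M : Term) : appS {M} T = T.map fun P => Expr.app M P := by
  simp [appS]
theorem appS_singleton_right (P : Bag) : appS S {P} = S.map fun M => Expr.app M P := by
  simp [appS, Multiset.bind_singleton]
theorem mem_appS {M : Term} : M ∈ appS S T ↔ ∃ M₀ ∈ S, ∃ P ∈ T, Expr.app M₀ P = M := by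
  simp [appS]

@[simp] theorem consS_zero_left : consS 0 T = 0 := rfl
@[simp] theorem consS_zero_right : consS S 0 = 0 := by simp [consS]
@[simp] theorem consS_singleton (M : Term) (P : Bag) :
    consS {M} {P} = {Expr.cons .linear M P} := by
  simp [consS]
theorem consS_add_left : consS (S + S') T = consS S T + consS S' T := Multiset.add_bind _ _ _
theorem consS_add_right : consS S (T + T') = consS S T + consS S T' := by
  simp [consS, Multiset.bind_add]
theorem consS_bind_left (U : Multiset α) (f : α → FormalSum .term) :
    consS (U.bind f) T = U.bind fun a => consS (f a) T := Multiset.bind_assoc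
theorem consS_bind_right (U : Multiset α) (f : α → FormalSum .bag) :
    consS S (U.bind f) = U.bind fun a => consS S (f a) := by
  simp only [consS, Multiset.map_bind]; exact Multiset.bind_bind _ _
theorem consS_singleton_left (M : Term) :
    consS {M} T = T.map fun P => Expr.cons .linear M P := by
  simp [consS]
theorem consS_singleton_right (P : Bag) :
    consS S {P} = S.map fun M => Expr.cons .linear M P := by
  simp [consS, Multiset.bind_singleton]
theorem mem_consS {P : Bag} :
    P ∈ consS S T ↔ ∃ M ∈ S, ∃ P₀ ∈ T, Expr.cons .linear M P₀ = P := by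
  simp [consS]

@[simp] theorem bangS_zero_left : bangS 0 T = T := by simp [bangS]
@[simp] theorem bangS_zero_right : bangS S 0 = 0 := rfl
@[simp] theorem bangS_singleton (P : Bag) : bangS S {P} = {bangSum S P} := rfl
theorem bangS_add_left : bangS (S + S') T = bangS S (bangS S' T) := by
  simp [bangS, bangSum_add]
theorem bangS_add_right : bangS S (T + T') = bangS S T + bangS S T' := Multiset.map_add _ _ _
theorem bangS_bind_right (U : Multiset α) (f : α → FormalSum .bag) :
    bangS S (U.bind f) = U.bind fun a => bangS S (f a) := Multiset.map_bind _ _ _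
theorem mem_bangS {P : Bag} : P ∈ bangS S T ↔ ∃ P₀ ∈ T, bangSum S P₀ = P := Multiset.mem_map

theorem consS_left_comm : consS S (consS S' T) = consS S' (consS S T) := by
  simp only [consS, Multiset.map_bind, Multiset.map_map, Function.comp_def]
  rw [Multiset.bind_bind]
  simp only [Expr.cons_swap]

theorem bangS_left_comm : bangS S (bangS S' T) = bangS S' (bangS S T) := by
  rw [← bangS_add_left, add_comm, bangS_add_left]

theorem bangS_consS : bangS S (consS S' T) = consS S' (bangS S T) := by
  simp [bangS, consS, Multiset.map_bind, bangSum_cons]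

end Sums

/-! ### Differential substitution -/

/-- A direction (a sum of terms for every index), under one binder. -/
def liftDir (D : ℕ → FormalSum .term) : ℕ → FormalSum .term
  | 0 => 0
  | n + 1 => (D n).map Expr.shift

/-- The derivative, in the direction `D`, of the substitution of `σ` in a raw expression. -/
def PreExpr.dsubst :
    {s : Kind} → (ℕ → FormalSum .term) → (ℕ → FormalSum .term) → PreExpr s → FormalSum s
  | _, _, D, .var n => D n
  | _, σ, D, .lam m => lamS (m.dsubst (liftSub σ) (liftDir D))
  | _, σ, D, .app m p => appS (m.dsubst σ D) (p.subst σ) + appS (m.subst σ) (p.dsubst σ D)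
  | _, _, _, .one => 0
  | _, σ, D, .cons .linear m p =>
      consS (m.dsubst σ D) (p.subst σ) + consS (m.subst σ) (p.dsubst σ D)
  | _, σ, D, .cons .reusable m p =>
      consS (m.dsubst σ D) (bangS (m.subst σ) (p.subst σ)) + bangS (m.subst σ) (p.dsubst σ D)

theorem PreExpr.subst_linear (σ : ℕ → FormalSum .term) (m : PreExpr .term) (p : PreExpr .bag) :
    (PreExpr.cons .linear m p).subst σ = consS (m.subst σ) (p.subst σ) := rfl

theorem PreExpr.subst_reusable (σ : ℕ → FormalSum .term) (m : PreExpr .term)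
    (p : PreExpr .bag) :
    (PreExpr.cons .reusable m p).subst σ = bangS (m.subst σ) (p.subst σ) := rfl

theorem PreExpr.Equiv.dsubst {s : Kind} {a b : PreExpr s} (h : PreExpr.Equiv a b) :
    ∀ σ D : ℕ → FormalSum .term, a.dsubst σ D = b.dsubst σ D := by
  induction h with
  | refl a => exact fun _ _ => rfl
  | symm _ ih => exact fun σ D => (ih σ D).symm
  | trans _ _ ih ih' => exact fun σ D => (ih σ D).trans (ih' σ D)
  | lam _ ih => intro σ D; simp only [PreExpr.dsubst, ih]
  | app h h' ih ih' => intro σ D; simp only [PreExpr.dsubst, ih, ih', h.subst, h'.subst]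
  | cons r h h' ih ih' =>
    intro σ D; cases r <;> simp only [PreExpr.dsubst, ih, ih', h.subst, h'.subst]
  | swap r r' m m' p =>
    intro σ D
    cases r <;> cases r' <;>
      simp only [PreExpr.dsubst, PreExpr.subst_linear, PreExpr.subst_reusable, consS_add_right,
        bangS_add_right, bangS_consS]
    · rw [consS_left_comm (m.dsubst σ D), consS_left_comm (m.subst σ) (m'.dsubst σ D),
        consS_left_comm (m.subst σ) (m'.subst σ)]
      abel
    · rw [consS_left_comm (m.subst σ)]
      abel
    · rw [consS_left_comm (m.dsubst σ D)]
      abel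
    · rw [bangS_left_comm (m.subst σ) (m'.subst σ), bangS_left_comm (m.subst σ) (m'.subst σ)]
      abel

/-- The derivative, in the direction `D`, of the substitution of `σ` in an expression. -/
def Expr.dsubst {s : Kind} (σ D : ℕ → FormalSum .term) : Expr s → FormalSum s :=
  Quotient.lift (fun a => a.dsubst σ D) fun _ _ h => PreExpr.Equiv.dsubst h σ D

namespace Expr

variable (σ τ D E : ℕ → FormalSum .term) (ρ ρ' : ℕ → ℕ) (M : Term) (P : Bag) (x : ℕ) (N : Term)

@[simp] theorem rename_var (n : ℕ) : (var n).rename ρ = var (ρ n) := rfl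
@[simp] theorem rename_lam : (lam M).rename ρ = lam (M.rename (liftRen ρ)) := by
  induction M using Quotient.inductionOn; rfl
@[simp] theorem rename_app : (app M P).rename ρ = app (M.rename ρ) (P.rename ρ) := by
  induction M using Quotient.inductionOn; induction P using Quotient.inductionOn; rfl
@[simp] theorem rename_one : one.rename ρ = one := rfl
@[simp] theorem rename_cons (r : Mode) :
    (cons r M P).rename ρ = cons r (M.rename ρ) (P.rename ρ) := by
  induction M using Quotient.inductionOn; induction P using Quotient.inductionOn; rfl

@[simp] theorem subst_var (n : ℕ) : (var n).subst σ = σ n := rfl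
@[simp] theorem subst_lam : (lam M).subst σ = lamS (M.subst (liftSub σ)) := by
  induction M using Quotient.inductionOn; rfl
@[simp] theorem subst_app : (app M P).subst σ = appS (M.subst σ) (P.subst σ) := by
  induction M using Quotient.inductionOn; induction P using Quotient.inductionOn; rfl
@[simp] theorem subst_one : one.subst σ = {one} := rfl
@[simp] theorem subst_linear : (cons .linear M P).subst σ = consS (M.subst σ) (P.subst σ) := by
  induction M using Quotient.inductionOn; induction P using Quotient.inductionOn; rfl
@[simp] theorem subst_reusable :
    (cons .reusable M P).subst σ = bangS (M.subst σ) (P.subst σ) := by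
  induction M using Quotient.inductionOn; induction P using Quotient.inductionOn; rfl

@[simp] theorem dsubst_var (n : ℕ) : (var n).dsubst σ D = D n := rfl
@[simp] theorem dsubst_lam :
    (lam M).dsubst σ D = lamS (M.dsubst (liftSub σ) (liftDir D)) := by
  induction M using Quotient.inductionOn; rfl
@[simp] theorem dsubst_app : (app M P).dsubst σ D =
    appS (M.dsubst σ D) (P.subst σ) + appS (M.subst σ) (P.dsubst σ D) := by
  induction M using Quotient.inductionOn; induction P using Quotient.inductionOn; rfl
@[simp] theorem dsubst_one : one.dsubst σ D = 0 := rfl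
@[simp] theorem dsubst_linear : (cons .linear M P).dsubst σ D =
    consS (M.dsubst σ D) (P.subst σ) + consS (M.subst σ) (P.dsubst σ D) := by
  induction M using Quotient.inductionOn; induction P using Quotient.inductionOn; rfl
@[simp] theorem dsubst_reusable : (cons .reusable M P).dsubst σ D =
    consS (M.dsubst σ D) (bangS (M.subst σ) (P.subst σ)) +
      bangS (M.subst σ) (P.dsubst σ D) := by
  induction M using Quotient.inductionOn; induction P using Quotient.inductionOn; rfl

@[simp] theorem linSubst_var (n : ℕ) : (var n).linSubst x N = if n = x then {N} else 0 := rfl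
@[simp] theorem linSubst_lam :
    (lam M).linSubst x N = lamS (M.linSubst (x + 1) N.shift) := by
  induction M using Quotient.inductionOn; rfl
@[simp] theorem linSubst_app : (app M P).linSubst x N =
    appS (M.linSubst x N) {P} + appS {M} (P.linSubst x N) := by
  rw [appS_singleton_left, appS_singleton_right]
  induction M using Quotient.inductionOn; induction P using Quotient.inductionOn; rfl
@[simp] theorem linSubst_one : one.linSubst x N = 0 := rfl
@[simp] theorem linSubst_linear : (cons .linear M P).linSubst x N =
    consS (M.linSubst x N) {P} + consS {M} (P.linSubst x N) := by
  rw [consS_singleton_left, consS_singleton_right]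
  induction M using Quotient.inductionOn; induction P using Quotient.inductionOn; rfl
@[simp] theorem linSubst_reusable : (cons .reusable M P).linSubst x N =
    consS (M.linSubst x N) (bangS {M} {P}) + bangS {M} (P.linSubst x N) := by
  rw [bangS_singleton, bangSum_singleton, consS_singleton_right]
  simp only [bangS, bangSum_singleton]
  induction M using Quotient.inductionOn; induction P using Quotient.inductionOn; rfl

/-! ### Renaming and substitution -/

theorem rename_rename {s : Kind} (A : Expr s) :
    ∀ ρ ρ' : ℕ → ℕ, (A.rename ρ).rename ρ' = A.rename (ρ' ∘ ρ) := by
  induction A using Expr.induction with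
  | var n => intro ρ ρ'; rfl
  | lam M ih =>
    intro ρ ρ'
    have : liftRen (ρ' ∘ ρ) = liftRen ρ' ∘ liftRen ρ := by funext n; cases n <;> rfl
    simp [ih, this]
  | app M P ih ih' => intro ρ ρ'; simp [ih, ih']
  | one => intro ρ ρ'; rfl
  | cons r M P ih ih' => intro ρ ρ'; simp [ih, ih']

theorem liftSub_comp_liftRen : liftSub σ ∘ liftRen ρ = liftSub (σ ∘ ρ) := by
  funext n; cases n <;> rfl

theorem liftDir_comp_liftRen : liftDir σ ∘ liftRen ρ = liftDir (σ ∘ ρ) := by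
  funext n; cases n <;> rfl

theorem subst_rename {s : Kind} (A : Expr s) :
    ∀ (ρ : ℕ → ℕ) (τ : ℕ → FormalSum .term), (A.rename ρ).subst τ = A.subst (τ ∘ ρ) := by
  induction A using Expr.induction with
  | var n => intro ρ τ; rfl
  | lam M ih => intro ρ τ; simp [ih, liftSub_comp_liftRen]
  | app M P ih ih' => intro ρ τ; simp [ih, ih']
  | one => intro ρ τ; rfl
  | cons r M P ih ih' => intro ρ τ; cases r <;> simp [ih, ih']

theorem dsubst_rename {s : Kind} (A : Expr s) :
    ∀ (ρ : ℕ → ℕ) (τ E : ℕ → FormalSum .term),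
      (A.rename ρ).dsubst τ E = A.dsubst (τ ∘ ρ) (E ∘ ρ) := by
  induction A using Expr.induction with
  | var n => intro ρ τ E; rfl
  | lam M ih => intro ρ τ E; simp [ih, liftSub_comp_liftRen, liftDir_comp_liftRen]
  | app M P ih ih' => intro ρ τ E; simp [ih, ih', subst_rename]
  | one => intro ρ τ E; rfl
  | cons r M P ih ih' => intro ρ τ E; cases r <;> simp [ih, ih', subst_rename]

theorem rename_shift {s : Kind} (A : Expr s) :
    A.shift.rename (liftRen ρ) = (A.rename ρ).shift := by
  simp only [shift, rename_rename]; rfl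

theorem subst_shift {s : Kind} (A : Expr s) : A.shift.subst τ = A.subst fun n => τ (n + 1) :=
  subst_rename A _ _

end Expr

theorem map_rename_lamS (ρ : ℕ → ℕ) (S : FormalSum .term) :
    (lamS S).map (Expr.rename ρ) = lamS (S.map (Expr.rename (liftRen ρ))) := by
  simp [lamS, Multiset.map_map]

theorem map_rename_appS (ρ : ℕ → ℕ) (S : FormalSum .term) (T : FormalSum .bag) :
    (appS S T).map (Expr.rename ρ) = appS (S.map (Expr.rename ρ)) (T.map (Expr.rename ρ)) := by
  simp [appS, Multiset.map_map, Multiset.map_bind, Multiset.bind_map]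

theorem map_rename_consS (ρ : ℕ → ℕ) (S : FormalSum .term) (T : FormalSum .bag) :
    (consS S T).map (Expr.rename ρ) =
      consS (S.map (Expr.rename ρ)) (T.map (Expr.rename ρ)) := by
  simp [consS, Multiset.map_map, Multiset.map_bind, Multiset.bind_map]

theorem rename_bangSum (ρ : ℕ → ℕ) (S : FormalSum .term) (P : Bag) :
    (bangSum S P).rename ρ = bangSum (S.map (Expr.rename ρ)) (P.rename ρ) := by
  induction S using Multiset.induction_on with
  | empty => simp
  | cons a S ih => simp [ih]

theorem map_rename_bangS (ρ : ℕ → ℕ) (S : FormalSum .term) (T : FormalSum .bag) :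
    (bangS S T).map (Expr.rename ρ) =
      bangS (S.map (Expr.rename ρ)) (T.map (Expr.rename ρ)) := by
  simp [bangS, Multiset.map_map, rename_bangSum]

theorem liftSub_map_rename (ρ : ℕ → ℕ) (σ : ℕ → FormalSum .term) :
    (fun n => (liftSub σ n).map (Expr.rename (liftRen ρ))) =
      liftSub fun n => (σ n).map (Expr.rename ρ) := by
  funext n
  cases n with
  | zero => rfl
  | succ n => simp [liftSub, Multiset.map_map, Expr.rename_shift]

theorem liftDir_map_rename (ρ : ℕ → ℕ) (σ : ℕ → FormalSum .term) :
    (fun n => (liftDir σ n).map (Expr.rename (liftRen ρ))) =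
      liftDir fun n => (σ n).map (Expr.rename ρ) := by
  funext n
  cases n with
  | zero => rfl
  | succ n => simp [liftDir, Multiset.map_map, Expr.rename_shift]

namespace Expr

theorem map_rename_subst {s : Kind} (A : Expr s) : ∀ (ρ : ℕ → ℕ) (σ : ℕ → FormalSum .term),
    (A.subst σ).map (rename ρ) = A.subst fun n => (σ n).map (rename ρ) := by
  induction A using Expr.induction with
  | var n => intro ρ σ; rfl
  | lam M ih => intro ρ σ; simp [map_rename_lamS, ih, liftSub_map_rename]
  | app M P ih ih' => intro ρ σ; simp [map_rename_appS, ih, ih']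
  | one => intro ρ σ; rfl
  | cons r M P ih ih' =>
    intro ρ σ; cases r <;> simp [map_rename_consS, map_rename_bangS, ih, ih']

theorem map_rename_dsubst {s : Kind} (A : Expr s) :
    ∀ (ρ : ℕ → ℕ) (σ D : ℕ → FormalSum .term), (A.dsubst σ D).map (rename ρ) =
      A.dsubst (fun n => (σ n).map (rename ρ)) fun n => (D n).map (rename ρ) := by
  induction A using Expr.induction with
  | var n => intro ρ σ D; rfl
  | lam M ih =>
    intro ρ σ D; simp [map_rename_lamS, ih, liftSub_map_rename, liftDir_map_rename]
  | app M P ih ih' => intro ρ σ D; simp [map_rename_appS, ih, ih', map_rename_subst]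
  | one => intro ρ σ D; rfl
  | cons r M P ih ih' =>
    intro ρ σ D
    cases r <;> simp [map_rename_consS, map_rename_bangS, ih, ih', map_rename_subst]

end Expr

/-! ### Substitution in sums -/

/-- Substitution in a sum. -/
def substS {s : Kind} (σ : ℕ → FormalSum .term) (S : FormalSum s) : FormalSum s :=
  S.bind (Expr.subst σ)

/-- Differential substitution in a sum. -/
def dsubstS {s : Kind} (σ D : ℕ → FormalSum .term) (S : FormalSum s) : FormalSum s :=
  S.bind (Expr.dsubst σ D)

section Sums

variable {s : Kind} (σ τ D E : ℕ → FormalSum .term) (ρ : ℕ → ℕ)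

@[simp] theorem substS_zero : substS σ (0 : FormalSum s) = 0 := rfl
@[simp] theorem substS_singleton (A : Expr s) : substS σ {A} = A.subst σ := by simp [substS]
theorem substS_add (S T : FormalSum s) : substS σ (S + T) = substS σ S + substS σ T :=
  Multiset.add_bind _ _ _
theorem substS_cons (A : Expr s) (T : FormalSum s) :
    substS σ (A ::ₘ T) = A.subst σ + substS σ T :=
  Multiset.cons_bind _ _ _
theorem substS_bind {α : Type*} (U : Multiset α) (f : α → FormalSum s) :
    substS σ (U.bind f) = U.bind fun a => substS σ (f a) := Multiset.bind_assoc
theorem mem_substS {S : FormalSum s} {A : Expr s} : A ∈ substS σ S ↔ ∃ B ∈ S, A ∈ B.subst σ :=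
  Multiset.mem_bind

@[simp] theorem dsubstS_zero : dsubstS σ D (0 : FormalSum s) = 0 := rfl
@[simp] theorem dsubstS_singleton (A : Expr s) : dsubstS σ D {A} = A.dsubst σ D := by
  simp [dsubstS]
theorem dsubstS_add (S T : FormalSum s) :
    dsubstS σ D (S + T) = dsubstS σ D S + dsubstS σ D T :=
  Multiset.add_bind _ _ _
theorem dsubstS_bind {α : Type*} (U : Multiset α) (f : α → FormalSum s) :
    dsubstS σ D (U.bind f) = U.bind fun a => dsubstS σ D (f a) := Multiset.bind_assoc

theorem substS_map_rename (S : FormalSum s) :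
    substS τ (S.map (Expr.rename ρ)) = substS (τ ∘ ρ) S := by
  simp [substS, Multiset.bind_map, Expr.subst_rename]

theorem dsubstS_map_rename (S : FormalSum s) :
    dsubstS τ E (S.map (Expr.rename ρ)) = dsubstS (τ ∘ ρ) (E ∘ ρ) S := by
  simp [dsubstS, Multiset.bind_map, Expr.dsubst_rename]

theorem map_rename_substS (S : FormalSum s) :
    (substS σ S).map (Expr.rename ρ) = substS (fun n => (σ n).map (Expr.rename ρ)) S := by
  simp [substS, Multiset.map_bind, Expr.map_rename_subst]

theorem map_rename_dsubstS (S : FormalSum s) :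
    (dsubstS σ D S).map (Expr.rename ρ) =
      dsubstS (fun n => (σ n).map (Expr.rename ρ)) (fun n => (D n).map (Expr.rename ρ)) S := by
  simp [dsubstS, Multiset.map_bind, Expr.map_rename_dsubst]

theorem substS_map_shift (S : FormalSum s) :
    substS τ (S.map Expr.shift) = substS (fun n => τ (n + 1)) S :=
  substS_map_rename _ _ _

theorem dsubstS_map_shift (S : FormalSum s) :
    dsubstS τ E (S.map Expr.shift) = dsubstS (fun n => τ (n + 1)) (fun n => E (n + 1)) S :=
  dsubstS_map_rename _ _ _ _

theorem substS_lamS (S : FormalSum .term) : substS τ (lamS S) = lamS (substS (liftSub τ) S) := by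
  simp only [substS, lamS_bind]; simp [lamS, Multiset.bind_map]

theorem substS_appS (S : FormalSum .term) (T : FormalSum .bag) :
    substS τ (appS S T) = appS (substS τ S) (substS τ T) := by
  simp only [substS, appS_bind_left]
  simp only [appS_bind_right]
  simp [appS, Multiset.bind_assoc, Multiset.bind_map]

theorem substS_consS (S : FormalSum .term) (T : FormalSum .bag) :
    substS τ (consS S T) = consS (substS τ S) (substS τ T) := by
  simp only [substS, consS_bind_left]
  simp only [consS_bind_right]
  simp [consS, Multiset.bind_assoc, Multiset.bind_map]

theorem subst_bangSum (S : FormalSum .term) (P : Bag) :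
    (bangSum S P).subst τ = bangS (substS τ S) (P.subst τ) := by
  induction S using Multiset.induction_on with
  | empty => simp
  | cons a S ih => simp [ih, substS_cons, bangS_add_left]

theorem substS_bangS (S : FormalSum .term) (T : FormalSum .bag) :
    substS τ (bangS S T) = bangS (substS τ S) (substS τ T) := by
  rw [substS.eq_1 τ T, bangS_bind_right]
  simp [bangS, substS, Multiset.bind_map, subst_bangSum]

theorem dsubstS_lamS (S : FormalSum .term) :
    dsubstS τ E (lamS S) = lamS (dsubstS (liftSub τ) (liftDir E) S) := by
  simp only [dsubstS, lamS_bind]; simp [lamS, Multiset.bind_map]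

theorem dsubstS_appS (S : FormalSum .term) (T : FormalSum .bag) : dsubstS τ E (appS S T) =
    appS (dsubstS τ E S) (substS τ T) + appS (substS τ S) (dsubstS τ E T) := by
  simp only [substS, dsubstS, appS_bind_left]
  simp only [appS_bind_right]
  rw [← Multiset.bind_add]
  simp only [← Multiset.bind_add]
  simp [appS, Multiset.bind_assoc, Multiset.bind_map]

theorem dsubstS_consS (S : FormalSum .term) (T : FormalSum .bag) : dsubstS τ E (consS S T) =
    consS (dsubstS τ E S) (substS τ T) + consS (substS τ S) (dsubstS τ E T) := by
  simp only [substS, dsubstS, consS_bind_left]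
  simp only [consS_bind_right]
  rw [← Multiset.bind_add]
  simp only [← Multiset.bind_add]
  simp [consS, Multiset.bind_assoc, Multiset.bind_map]

/-- Differentiating a reusable resource extracts a linear copy and keeps the original. So the first
summand carries the derivative of one member of `S` next to the whole undiminished group. -/
theorem dsubst_bangSum (S : FormalSum .term) (P : Bag) : (bangSum S P).dsubst τ E =
    consS (dsubstS τ E S) (bangS (substS τ S) (P.subst τ)) +
      bangS (substS τ S) (P.dsubst τ E) := by
  induction S using Multiset.induction_on with
  | empty => simp
  | cons a S ih =>
    have h : dsubstS τ E (a ::ₘ S) = a.dsubst τ E + dsubstS τ E S := Multiset.cons_bind _ _ _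
    rw [bangSum_cons_left, Expr.dsubst_reusable, ih, h, substS_cons, subst_bangSum,
      bangS_add_right, bangS_consS, bangS_add_left, bangS_add_left, consS_add_left, add_assoc]

theorem dsubstS_bangS (S : FormalSum .term) (T : FormalSum .bag) : dsubstS τ E (bangS S T) =
    consS (dsubstS τ E S) (bangS (substS τ S) (substS τ T)) +
      bangS (substS τ S) (dsubstS τ E T) := by
  rw [substS.eq_1 τ T, dsubstS.eq_1 τ E T, bangS_bind_right, consS_bind_right, bangS_bind_right,
    ← Multiset.bind_add]
  rw [dsubstS, bangS, Multiset.bind_map]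
  exact Multiset.bind_congr fun P _ => dsubst_bangSum τ E S P

end Sums

/-! ### Composition of substitutions -/

theorem liftSub_substS (σ τ : ℕ → FormalSum .term) :
    (fun n => substS (liftSub τ) (liftSub σ n)) = liftSub fun n => substS τ (σ n) := by
  funext n
  cases n with
  | zero => simp [liftSub]
  | succ n =>
    simp only [liftSub, substS_map_shift]
    exact (map_rename_substS _ _ _).symm

theorem liftDir_substS (D τ : ℕ → FormalSum .term) :
    (fun n => substS (liftSub τ) (liftDir D n)) = liftDir fun n => substS τ (D n) := by
  funext n
  cases n with
  | zero => simp [liftDir]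
  | succ n =>
    simp only [liftDir, substS_map_shift]
    exact (map_rename_substS _ _ _).symm

theorem liftDir_dsubstS (σ τ E : ℕ → FormalSum .term) :
    (fun n => dsubstS (liftSub τ) (liftDir E) (liftSub σ n)) =
      liftDir fun n => dsubstS τ E (σ n) := by
  funext n
  cases n with
  | zero => simp [liftDir, liftSub]
  | succ n =>
    simp only [liftDir, liftSub, dsubstS_map_shift]
    exact (map_rename_dsubstS _ _ _ _).symm

theorem liftDir_dsubstS_liftDir (D τ E : ℕ → FormalSum .term) :
    (fun n => dsubstS (liftSub τ) (liftDir E) (liftDir D n)) =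
      liftDir fun n => dsubstS τ E (D n) := by
  funext n
  cases n with
  | zero => simp [liftDir]
  | succ n =>
    simp only [liftDir, liftSub, dsubstS_map_shift]
    exact (map_rename_dsubstS _ _ _ _).symm

/-- Together with `substS_dsubst` and `dsubstS_subst` this is the calculus of composition; the last
of them is the chain rule. The three inductions work because each constructor on sums commutes with
substitution and obeys a Leibniz rule. -/
theorem substS_subst {s : Kind} (A : Expr s) : ∀ σ τ : ℕ → FormalSum .term,
    substS τ (A.subst σ) = A.subst fun n => substS τ (σ n) := by
  induction A using Expr.induction with
  | var n => intro σ τ; rfl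
  | lam M ih => intro σ τ; simp [substS_lamS, ih, liftSub_substS]
  | app M P ih ih' => intro σ τ; simp [substS_appS, ih, ih']
  | one => intro σ τ; simp
  | cons r M P ih ih' => intro σ τ; cases r <;> simp [substS_consS, substS_bangS, ih, ih']

theorem substS_dsubst {s : Kind} (A : Expr s) : ∀ σ D τ : ℕ → FormalSum .term,
    substS τ (A.dsubst σ D) = A.dsubst (fun n => substS τ (σ n)) fun n => substS τ (D n) := by
  induction A using Expr.induction with
  | var n => intro σ D τ; rfl
  | lam M ih => intro σ D τ; simp [substS_lamS, ih, liftSub_substS, liftDir_substS]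
  | app M P ih ih' => intro σ D τ; simp [substS_add, substS_appS, ih, ih', substS_subst]
  | one => intro σ D τ; simp
  | cons r M P ih ih' =>
    intro σ D τ
    cases r <;> simp [substS_add, substS_consS, substS_bangS, ih, ih', substS_subst]

theorem dsubstS_subst {s : Kind} (A : Expr s) : ∀ σ τ E : ℕ → FormalSum .term,
    dsubstS τ E (A.subst σ) =
      A.dsubst (fun n => substS τ (σ n)) fun n => dsubstS τ E (σ n) := by
  induction A using Expr.induction with
  | var n => intro σ τ E; rfl
  | lam M ih => intro σ τ E; simp [dsubstS_lamS, ih, liftSub_substS, liftDir_dsubstS]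
  | app M P ih ih' => intro σ τ E; simp [dsubstS_appS, ih, ih', substS_subst]
  | one => intro σ τ E; simp
  | cons r M P ih ih' =>
    intro σ τ E; cases r <;> simp [dsubstS_consS, dsubstS_bangS, ih, ih', substS_subst]

/-! ### The identity substitution and the second derivative -/

/-- The identity substitution. -/
def idSub (n : ℕ) : FormalSum .term := {Expr.var n}

@[simp] theorem liftSub_idSub : liftSub idSub = idSub := by
  funext n; cases n <;> rfl

@[simp] theorem Expr.subst_idSub {s : Kind} (A : Expr s) : A.subst idSub = {A} := by
  induction A using Expr.induction with
  | var n => rfl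
  | lam M ih => simp [ih]
  | app M P ih ih' => simp [ih, ih']
  | one => rfl
  | cons r M P ih ih' => cases r <;> simp [ih, ih']

@[simp] theorem substS_idSub {s : Kind} (S : FormalSum s) : substS idSub S = S := by
  simpa [substS] using Multiset.bind_singleton S id

theorem Expr.subst_var_comp {s : Kind} (A : Expr s) (ρ : ℕ → ℕ) :
    (A.subst fun n => {Expr.var (ρ n)}) = {A.rename ρ} := by
  rw [← Expr.subst_idSub (A.rename ρ), Expr.subst_rename]; rfl

theorem liftDir_add (D E : ℕ → FormalSum .term) : liftDir (D + E) = liftDir D + liftDir E := by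
  funext n; cases n <;> simp [liftDir]

@[simp] theorem liftDir_zero : liftDir 0 = 0 := by
  funext n; cases n <;> simp [liftDir]

theorem Expr.dsubst_add {s : Kind} (A : Expr s) : ∀ σ D E : ℕ → FormalSum .term,
    A.dsubst σ (D + E) = A.dsubst σ D + A.dsubst σ E := by
  induction A using Expr.induction with
  | var n => intro σ D E; rfl
  | lam M ih => intro σ D E; simp [liftDir_add, ih, lamS_add]
  | app M P ih ih' => intro σ D E; simp [ih, ih', appS_add_left, appS_add_right]; abel
  | one => intro σ D E; simp
  | cons r M P ih ih' =>
    intro σ D E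
    cases r <;> simp [ih, ih', consS_add_left, consS_add_right, bangS_add_right] <;> abel

@[simp] theorem Expr.dsubst_zero {s : Kind} (A : Expr s) : ∀ σ : ℕ → FormalSum .term,
    A.dsubst σ 0 = 0 := by
  induction A using Expr.induction with
  | var n => intro σ; rfl
  | lam M ih => intro σ; simp [ih]
  | app M P ih ih' => intro σ; simp [ih, ih']
  | one => intro σ; simp
  | cons r M P ih ih' => intro σ; cases r <;> simp [ih, ih']

/-- Symmetry of the second derivative. -/
theorem dsubstS_dsubst_comm {s : Kind} (A : Expr s) : ∀ D E : ℕ → FormalSum .term,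
    dsubstS idSub E (A.dsubst idSub D) + A.dsubst idSub (fun n => dsubstS idSub D (E n)) =
      dsubstS idSub D (A.dsubst idSub E) + A.dsubst idSub fun n => dsubstS idSub E (D n) := by
  induction A using Expr.induction with
  -- Directions may themselves contain variables, so an iterated derivative also differentiates the
  -- inner direction. The extra summand on each side balances this without any subtraction; for a
  -- variable only these terms are present.
  | var n => intro D E; simp [add_comm]
  | lam M ih =>
    intro D E
    have h := congrArg lamS (ih (liftDir D) (liftDir E))
    have e : ∀ D E, (fun n => dsubstS idSub (liftDir E) (liftDir D n)) =
      liftDir fun n => dsubstS idSub E (D n) := fun D E => by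
        simpa using liftDir_dsubstS_liftDir D idSub E
    simpa [dsubstS_lamS, lamS_add, e] using h
  | app M P ih ih' =>
    intro D E
    have h := congrArg (appS · {P}) (ih D E)
    have h' := congrArg (appS {M}) (ih' D E)
    simp only [appS_add_left, appS_add_right] at h h'
    simp only [Expr.dsubst_app, Expr.subst_idSub, dsubstS_add, dsubstS_appS, substS_idSub,
      dsubstS_singleton]
    -- The mixed terms, with one derivative in each component, are the same on both sides; the
    -- induction hypotheses settle the others.
    have := congrArg₂ (· + ·) h h'
    grind
  | one => intro D E; simp
  | cons r M P ih ih' =>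
    intro D E
    cases r
    · have h := congrArg (consS · {P}) (ih D E)
      have h' := congrArg (consS {M}) (ih' D E)
      simp only [consS_add_left, consS_add_right] at h h'
      simp only [Expr.dsubst_linear, Expr.subst_idSub, dsubstS_add, dsubstS_consS, substS_idSub,
        dsubstS_singleton]
      have := congrArg₂ (· + ·) h h'
      grind
    · have h := congrArg (consS · (bangS {M} {P})) (ih D E)
      have h' := congrArg (bangS {M}) (ih' D E)
      simp only [consS_add_left, bangS_add_right] at h h'
      simp only [Expr.dsubst_reusable, Expr.subst_idSub, dsubstS_add, dsubstS_consS,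
        dsubstS_bangS, substS_idSub, dsubstS_singleton, consS_add_right]
      -- Both derivatives may extract a linear copy of the same reusable resource; the two copies
      -- are exchanged.
      rw [consS_left_comm (M.dsubst idSub D) (M.dsubst idSub E)]
      have := congrArg₂ (· + ·) h h'
      grind

/-! ### Linear and partial substitution -/

/-- The direction `S` at the index `x`, and `0` at the other indices. -/
def singleDir (x : ℕ) (S : FormalSum .term) (n : ℕ) : FormalSum .term := if n = x then S else 0

theorem liftDir_singleDir (x : ℕ) (S : FormalSum .term) :
    liftDir (singleDir x S) = singleDir (x + 1) (S.map Expr.shift) := by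
  funext n
  cases n with
  | zero => simp [liftDir, singleDir]
  | succ n => by_cases h : n = x <;> simp [liftDir, singleDir, h]

/-- The link that makes the chain rule and the symmetry of second derivatives available for linear
substitution. -/
theorem Expr.linSubst_eq_dsubst {s : Kind} (A : Expr s) : ∀ (x : ℕ) (N : Term),
    A.linSubst x N = A.dsubst idSub (singleDir x {N}) := by
  induction A using Expr.induction with
  | var n => intro x N; rfl
  | lam M ih => intro x N; simp [ih, liftDir_singleDir]
  | app M P ih ih' => intro x N; simp [ih, ih']
  | one => intro x N; rfl
  | cons r M P ih ih' => intro x N; cases r <;> simp [ih, ih']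

theorem Expr.dsubst_bind {s : Kind} {α : Type*} (A : Expr s) (σ : ℕ → FormalSum .term)
    (U : Multiset α) (f : α → ℕ → FormalSum .term) :
    (A.dsubst σ fun n => U.bind fun a => f a n) = U.bind fun a => A.dsubst σ (f a) := by
  induction U using Multiset.induction_on with
  | empty => exact A.dsubst_zero σ
  | cons a U ih =>
    simp only [Multiset.cons_bind, ← ih]
    exact A.dsubst_add σ (f a) _

/-- The derivative in the direction of the sum `S` at `x` is a sum of linear substitutions. -/
theorem Expr.dsubst_singleDir {s : Kind} (A : Expr s) (x : ℕ) (S : FormalSum .term) :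
    A.dsubst idSub (singleDir x S) = S.bind fun N => A.linSubst x N := by
  simp only [Expr.linSubst_eq_dsubst]
  rw [← Expr.dsubst_bind]
  congr 1
  funext n
  by_cases h : n = x
  · simpa [singleDir, h] using (Multiset.bind_singleton S id).symm
  · simp [singleDir, h]

/-- The substitution `{S + x / x}` for the index `x = 0`. -/
def addSub (S : FormalSum .term) : ℕ → FormalSum .term
  | 0 => S + {Expr.var 0}
  | n + 1 => {Expr.var (n + 1)}

theorem Expr.partialSubst_zero {s : Kind} (A : Expr s) (N : Term) :
    A.partialSubst 0 N = A.subst (addSub {N}) := by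
  unfold Expr.partialSubst
  congr 1
  funext n
  cases n <;> simp [addSub]

/-- The substitution `{0 / x}` for the bound variable `x`. -/
def zeroSub : ℕ → FormalSum .term
  | 0 => 0
  | n + 1 => {Expr.var n}

theorem Expr.zeroSubst_eq {s : Kind} (A : Expr s) : A.zeroSubst = A.subst zeroSub := by
  unfold Expr.zeroSubst
  congr 1

/-- Substitution of a resource for the index `0` in a sum. -/
def resS {s : Kind} (r : Mode) (N : Term) (S : FormalSum s) : FormalSum s :=
  match r with
  | .linear => dsubstS idSub (singleDir 0 {N}) S
  | .reusable => substS (addSub {N}) S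

theorem bind_resSubst {s : Kind} (r : Mode) (N : Term) (S : FormalSum s) :
    (S.bind fun A => A.resSubst 0 r N) = resS r N S := by
  cases r
  · simp [Expr.resSubst, resS, dsubstS, Expr.linSubst_eq_dsubst]
  · simp [Expr.resSubst, resS, substS, Expr.partialSubst_zero]

theorem substS_substS {s : Kind} (σ τ : ℕ → FormalSum .term) (S : FormalSum s) :
    substS τ (substS σ S) = substS (fun n => substS τ (σ n)) S := by
  rw [substS.eq_1 σ, substS_bind]; simp only [substS_subst]; rfl

theorem substS_dsubstS {s : Kind} (σ D τ : ℕ → FormalSum .term) (S : FormalSum s) :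
    substS τ (dsubstS σ D S) =
      dsubstS (fun n => substS τ (σ n)) (fun n => substS τ (D n)) S := by
  rw [dsubstS.eq_1 σ, substS_bind]; simp only [substS_dsubst]; rfl

theorem dsubstS_substS {s : Kind} (σ τ E : ℕ → FormalSum .term) (S : FormalSum s) :
    dsubstS τ E (substS σ S) =
      dsubstS (fun n => substS τ (σ n)) (fun n => dsubstS τ E (σ n)) S := by
  rw [substS.eq_1 σ, dsubstS_bind]; simp only [dsubstS_subst]; rfl

theorem dsubstS_dsubstS_comm {s : Kind} (D E : ℕ → FormalSum .term) (S : FormalSum s) :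
    dsubstS idSub E (dsubstS idSub D S) + dsubstS idSub (fun n => dsubstS idSub D (E n)) S =
      dsubstS idSub D (dsubstS idSub E S) +
        dsubstS idSub (fun n => dsubstS idSub E (D n)) S := by
  rw [dsubstS.eq_1 idSub D S, dsubstS.eq_1 idSub E S, dsubstS_bind, dsubstS_bind]
  rw [dsubstS.eq_1 idSub _ S, dsubstS.eq_1 idSub _ S, ← Multiset.bind_add, ← Multiset.bind_add]
  simp only [dsubstS_dsubst_comm]

theorem dsubstS_dir_add {s : Kind} (σ D E : ℕ → FormalSum .term) (S : FormalSum s) :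
    dsubstS σ (D + E) S = dsubstS σ D S + dsubstS σ E S := by
  simp [dsubstS, Expr.dsubst_add, Multiset.bind_add]

@[simp] theorem dsubstS_dir_zero {s : Kind} (σ : ℕ → FormalSum .term) (S : FormalSum s) :
    dsubstS σ 0 S = 0 := by
  simp [dsubstS]

theorem dsubstS_singleDir_shift {s : Kind} (x : ℕ) (T : FormalSum .term) (S : FormalSum s) :
    dsubstS idSub (singleDir (x + 1) (T.map Expr.shift)) (S.map Expr.shift) =
      (dsubstS idSub (singleDir x T) S).map Expr.shift := by
  rw [dsubstS_map_shift, show (dsubstS idSub (singleDir x T) S).map Expr.shift = _ from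
    map_rename_dsubstS _ _ _ _]
  congr 1
  funext n
  by_cases h : n = x <;> simp [singleDir, h]
  rfl

theorem dsubstS_singleDir_zero_shift {s : Kind} (σ : ℕ → FormalSum .term) (T : FormalSum .term)
    (S : FormalSum s) : dsubstS σ (singleDir 0 T) (S.map Expr.shift) = 0 := by
  rw [dsubstS_map_shift]
  exact dsubstS_dir_zero _ _

theorem map_shift_eq_substS {s : Kind} (S : FormalSum s) :
    S.map Expr.shift = substS (fun n => {Expr.var (n + 1)}) S := by
  simp only [substS, Expr.subst_var_comp]
  exact (Multiset.bind_singleton S _).symm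

theorem substS_addSub_shift {s : Kind} (T : FormalSum .term) (S : FormalSum s) :
    substS (addSub T) (S.map Expr.shift) = S.map Expr.shift := by
  rw [substS_map_shift, map_shift_eq_substS]; rfl

theorem substS_zeroSub_shift {s : Kind} (S : FormalSum s) :
    substS zeroSub (S.map Expr.shift) = S := by
  rw [substS_map_shift]; exact substS_idSub S

/-- The shifted sums do not contain the index `0`, so the second substitution acts only on the
occurrence of `x` that the first one keeps. -/
theorem substS_addSub_addSub {s : Kind} (T U : FormalSum .term) (S : FormalSum s) :
    substS (addSub (T.map Expr.shift)) (substS (addSub (U.map Expr.shift)) S) =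
      substS (addSub ((T + U).map Expr.shift)) S := by
  rw [substS_substS]
  congr 1
  funext n
  cases n with
  | zero =>
    simp only [addSub, substS_add, substS_addSub_shift, substS_singleton, Expr.subst_var,
      Multiset.map_add]
    abel
  | succ n => simp [addSub]

-- Bag substitution and the giant step as functions

section Resources

variable {s : Kind}

theorem resS_add (r : Mode) (N : Term) (S T : FormalSum s) :
    resS r N (S + T) = resS r N S + resS r N T := by
  cases r
  · exact dsubstS_add _ _ _ _
  · exact substS_add _ _ _

@[simp] theorem resS_zero (r : Mode) (N : Term) : resS r N (0 : FormalSum s) = 0 := by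
  cases r <;> rfl

/-- By the chain rule both sides are derivatives of the same substitution. The directions agree
because neither `N.shift` nor `L.shift` contains the index `0`: differentiating `L + x` in the
direction `N` at `x` gives just `N`. -/
theorem resS_linear_reusable_comm (N L : Term) (S : FormalSum s) :
    resS .linear N.shift (resS .reusable L.shift S) =
      resS .reusable L.shift (resS .linear N.shift S) := by
  simp only [resS, dsubstS_substS, substS_dsubstS]
  congr 1
  · funext n; simp [idSub]
  · funext n
    rw [← Multiset.map_singleton Expr.shift N, ← Multiset.map_singleton Expr.shift L]
    cases n with
    | zero =>
      simp only [addSub, dsubstS_add, dsubstS_singleDir_zero_shift, singleDir, if_true,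
        substS_addSub_shift, dsubstS_singleton, Expr.dsubst_var, zero_add]
    | succ n => simp [addSub, singleDir]

/-- The order of substitution is immaterial because the resources do not contain the bound variable;
in the linear case this makes the correction terms of the second derivative vanish. Hence bag
substitution can be defined as a fold over a multiset. -/
theorem resS_comm (r r' : Mode) (N N' : Term) (S : FormalSum s) :
    resS r N.shift (resS r' N'.shift S) = resS r' N'.shift (resS r N.shift S) := by
  cases r <;> cases r'
  · have e : ∀ N N' : Term, (fun n => dsubstS idSub (singleDir 0 {N.shift})
        (singleDir 0 {N'.shift} n)) = 0 := fun N N' => by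
      funext n
      rw [← Multiset.map_singleton Expr.shift N']
      by_cases h : n = 0
      · simp only [h, singleDir, if_true]; exact dsubstS_singleDir_zero_shift _ _ _
      · simp [singleDir, h]
    simpa [e, resS] using dsubstS_dsubstS_comm (singleDir 0 {N'.shift}) (singleDir 0 {N.shift}) S
  · exact resS_linear_reusable_comm _ _ _
  · exact (resS_linear_reusable_comm _ _ _).symm
  · simp only [resS, ← Multiset.map_singleton Expr.shift]
    rw [substS_addSub_addSub, substS_addSub_addSub, add_comm]

theorem dsubstS_singleDir (x : ℕ) (T : FormalSum .term) (S : FormalSum s) :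
    dsubstS idSub (singleDir x T) S = T.bind fun N => dsubstS idSub (singleDir x {N}) S := by
  simp only [dsubstS, Expr.dsubst_singleDir, Multiset.singleton_bind]
  exact Multiset.bind_bind _ _

/-- Bag substitution for the index `0`, as a function; the bag lives outside of the binder. -/
def gsub (P : Bag) (S : FormalSum s) : FormalSum s :=
  haveI : RightCommutative fun (S : FormalSum s) (a : Mode × Term) => resS a.1 a.2.shift S :=
    ⟨fun S a b => resS_comm b.1 a.1 b.2 a.2 S⟩
  P.resources.foldl (fun S a => resS a.1 a.2.shift S) S

@[simp] theorem gsub_one (S : FormalSum s) : gsub Expr.one S = S := by simp [gsub]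

@[simp] theorem gsub_cons (r : Mode) (N : Term) (P : Bag) (S : FormalSum s) :
    gsub (Expr.cons r N P) S = gsub P (resS r N.shift S) := by simp [gsub]

theorem gsub_add (P : Bag) : ∀ S T : FormalSum s, gsub P (S + T) = gsub P S + gsub P T := by
  induction P using Expr.bagInduction with
  | one => simp
  | cons r M P ih => intro S T; simp [resS_add, ih]

@[simp] theorem gsub_zero (P : Bag) : gsub P (0 : FormalSum s) = 0 := by
  induction P using Expr.bagInduction with
  | one => simp
  | cons r M P ih => simp [ih]

theorem gsub_bind {α : Type*} (P : Bag) (U : Multiset α) (f : α → FormalSum s) :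
    gsub P (U.bind f) = U.bind fun a => gsub P (f a) := by
  induction U using Multiset.induction_on with
  | empty => simp
  | cons a U ih => simp [gsub_add, ih]

/-- Successive partial substitutions add up, so a group of reusable resources acts as a single
substitution of `T + x` for `x`. -/
theorem gsub_bangSum (T : FormalSum .term) (P : Bag) (S : FormalSum s) :
    gsub (bangSum T P) S = gsub P (substS (addSub (T.map Expr.shift)) S) := by
  induction T using Multiset.induction_on generalizing S with
  | empty =>
    have : addSub 0 = idSub := by funext n; cases n <;> simp [addSub, idSub]
    simp [this]
  | cons a T ih =>
    rw [bangSum_cons_left, gsub_cons, ih, resS, ← Multiset.map_singleton Expr.shift,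
      substS_addSub_addSub, add_comm, Multiset.singleton_add]

theorem substS_resS_linear (σ : ℕ → FormalSum .term) (L : Term) (S : FormalSum s) :
    substS (liftSub σ) (resS .linear L.shift S) =
      (L.subst σ).bind fun L' => resS .linear L'.shift (substS (liftSub σ) S) := by
  have h := dsubstS_singleDir 0 ((L.subst σ).map Expr.shift) (substS (liftSub σ) S)
  rw [Multiset.bind_map] at h
  simp only [resS]
  rw [← h, substS_dsubstS, dsubstS_substS]
  congr 1
  · funext n; simp [idSub]
  · funext n
    cases n with
    | zero =>
      simp only [singleDir, liftSub, if_true, substS_singleton, dsubstS_singleton,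
        Expr.dsubst_var, Expr.subst_shift]
      exact (Expr.map_rename_subst _ _ _).symm
    | succ n => rw [liftSub, dsubstS_singleDir_zero_shift]; simp [singleDir]

theorem substS_resS_reusable (σ : ℕ → FormalSum .term) (L : Term) (S : FormalSum s) :
    substS (liftSub σ) (resS .reusable L.shift S) =
      substS (addSub ((L.subst σ).map Expr.shift)) (substS (liftSub σ) S) := by
  simp only [resS]
  rw [substS_substS, substS_substS]
  congr 1
  funext n
  cases n with
  | zero =>
    simp only [addSub, liftSub, substS_add, substS_singleton, Expr.subst_var, Expr.subst_shift]
    congr 1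
    exact (Expr.map_rename_subst _ _ _).symm
  | succ n => rw [liftSub, substS_addSub_shift]; simp [addSub, liftSub]

/-- Symmetry of the second derivative. One correction term is zero, since `N.shift` does not contain
the index `0`; the other differentiates the resource `L` itself and yields the sum over `L⟨N/x⟩`. -/
theorem dsubstS_resS_linear (x : ℕ) (N L : Term) (S : FormalSum s) :
    dsubstS idSub (singleDir (x + 1) {N.shift}) (resS .linear L.shift S) =
      resS .linear L.shift (dsubstS idSub (singleDir (x + 1) {N.shift}) S) +
        (L.linSubst x N).bind fun L' => resS .linear L'.shift S := by
  have h := dsubstS_dsubstS_comm (singleDir 0 {L.shift}) (singleDir (x + 1) {N.shift}) S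
  have e₁ : (fun n => dsubstS idSub (singleDir 0 {L.shift}) (singleDir (x + 1) {N.shift} n)) =
      0 := by
    funext n
    rw [← Multiset.map_singleton Expr.shift N]
    by_cases h : n = x + 1
    · subst h; simp only [singleDir, if_true]; exact dsubstS_singleDir_zero_shift _ _ _
    · simp [singleDir, h]
  have e₂ : (fun n => dsubstS idSub (singleDir (x + 1) {N.shift}) (singleDir 0 {L.shift} n)) =
      singleDir 0 ((L.linSubst x N).map Expr.shift) := by
    funext n
    by_cases h : n = 0
    · simp only [singleDir, h, if_true, Expr.linSubst_eq_dsubst]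
      simpa using dsubstS_singleDir_shift x {N} {L}
    · simp [singleDir, h]
  rw [e₁, e₂, dsubstS_dir_zero, add_zero, dsubstS_singleDir 0 (Multiset.map _ _),
    Multiset.bind_map] at h
  exact h

/-- By the chain rule the derivative of `L + x` contributes `L⟨N/x⟩` as a linear resource, while `L`
remains available as a reusable one. This matches linear substitution in the bag `[L^!]·P`. -/
theorem dsubstS_resS_reusable (x : ℕ) (N L : Term) (S : FormalSum s) :
    dsubstS idSub (singleDir (x + 1) {N.shift}) (resS .reusable L.shift S) =
      resS .reusable L.shift (dsubstS idSub (singleDir (x + 1) {N.shift}) S) +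
        (L.linSubst x N).bind fun L' =>
          resS .reusable L.shift (resS .linear L'.shift S) := by
  have h := dsubstS_singleDir 0 ((L.linSubst x N).map Expr.shift) S
  rw [Multiset.bind_map] at h
  simp only [resS]
  rw [← substS_bind, ← h, ← substS_add, ← dsubstS_dir_add, dsubstS_substS, substS_dsubstS]
  congr 1
  · funext n; simp [idSub]
  · funext n
    simp only [Pi.add_apply, substS_add]
    cases n with
    | zero =>
      have h := dsubstS_singleDir_shift x {N} {L}
      simp only [Multiset.map_singleton, dsubstS_singleton] at h
      rw [← Expr.linSubst_eq_dsubst L x N] at h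
      have h' : singleDir (x + 1) {N.shift} 0 = 0 := by simp [singleDir]
      simp only [addSub, dsubstS_add, h, dsubstS_singleton, Expr.dsubst_var, h', substS_zero,
        add_zero, zero_add]
      simp only [singleDir, if_true, substS_addSub_shift]
    | succ n =>
      have h := substS_addSub_shift {L.shift} {N}
      simp only [Multiset.map_singleton, substS_singleton] at h
      by_cases e : n = x <;> simp [addSub, singleDir, e, h]

theorem substS_gsub (σ : ℕ → FormalSum .term) (P : Bag) : ∀ S : FormalSum s,
    substS (liftSub σ) (gsub P S) =
      (P.subst σ).bind fun P' => gsub P' (substS (liftSub σ) S) := by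
  induction P using Expr.bagInduction with
  | one => simp
  | cons r L P ih =>
    intro S
    cases r
    · simp only [gsub_cons, ih, substS_resS_linear, gsub_bind, Expr.subst_linear, consS,
        Multiset.bind_assoc, Multiset.bind_map]
      exact Multiset.bind_bind _ _
    · simp only [gsub_cons, ih, substS_resS_reusable, Expr.subst_reusable, bangS,
        Multiset.bind_map, gsub_bangSum]

theorem dsubstS_gsub (x : ℕ) (N : Term) (P : Bag) : ∀ S : FormalSum s,
    dsubstS idSub (singleDir (x + 1) {N.shift}) (gsub P S) =
      gsub P (dsubstS idSub (singleDir (x + 1) {N.shift}) S) +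
        (P.linSubst x N).bind fun P' => gsub P' S := by
  induction P using Expr.bagInduction with
  | one => simp
  | cons r L P ih =>
    intro S
    cases r
    · simp only [gsub_cons, ih, dsubstS_resS_linear, gsub_add, gsub_bind,
        Expr.linSubst_linear, consS_singleton_left, consS_singleton_right, Multiset.add_bind,
        Multiset.bind_map, add_assoc]
    · simp only [gsub_cons, ih, dsubstS_resS_reusable, gsub_add, gsub_bind,
        Expr.linSubst_reusable, bangS_singleton, bangSum_singleton, consS_singleton_right]
      simp only [bangS, Multiset.add_bind, Multiset.bind_map, bangSum_singleton, gsub_cons,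
        add_assoc]

/-- The giant step: bag substitution, followed by the substitution of `0`. -/
def giantS (P : Bag) (S : FormalSum s) : FormalSum s := substS zeroSub (gsub P S)

/-- Erasing the bound variable and then applying `σ` equals applying `σ` under the binder and then
erasing; the rest is the commutation of `σ` with bag substitution. -/
theorem substS_giantS (σ : ℕ → FormalSum .term) (P : Bag) (S : FormalSum s) :
    substS σ (giantS P S) = (P.subst σ).bind fun P' => giantS P' (substS (liftSub σ) S) := by
  simp only [giantS]
  rw [← substS_bind, ← substS_gsub, substS_substS, substS_substS]
  congr 1
  funext n
  cases n with
  | zero => simp [zeroSub, liftSub]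
  | succ n => simp only [liftSub, substS_zeroSub_shift]; simp [zeroSub]

/-- A Leibniz rule: the term substituted linearly goes either into the body of the abstraction or
into the bag. -/
theorem dsubstS_giantS (x : ℕ) (N : Term) (P : Bag) (S : FormalSum s) :
    dsubstS idSub (singleDir x {N}) (giantS P S) =
      giantS P (dsubstS idSub (singleDir (x + 1) {N.shift}) S) +
        (P.linSubst x N).bind fun P' => giantS P' S := by
  simp only [giantS]
  rw [← substS_bind, ← substS_add, ← dsubstS_gsub, dsubstS_substS, substS_dsubstS]
  congr 1
  · funext n; cases n <;> simp [zeroSub, idSub]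
  · funext n
    have h := substS_zeroSub_shift {N}
    simp only [Multiset.map_singleton, substS_singleton] at h
    cases n with
    | zero => simp [zeroSub, singleDir]
    | succ n => by_cases e : n = x <;> simp [zeroSub, singleDir, e, h]

theorem giantS_bind {α : Type*} (P : Bag) (U : Multiset α) (f : α → FormalSum s) :
    giantS P (U.bind f) = U.bind fun a => giantS P (f a) := by
  simp [giantS, gsub_bind, substS_bind]

end Resources

open Relation

/-! ### The giant step -/

namespace Expr

@[simp] theorem shift_one : one.shift = one := rfl

@[simp] theorem shift_cons (r : Mode) (M : Term) (P : Bag) :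
    (cons r M P).shift = cons r M.shift P.shift := rename_cons _ _ _ _

theorem shift_eq_cons {r : Mode} {N : Term} {P : Bag} : ∀ {Q : Bag},
    P.shift = cons r N Q → ∃ N₀ P₀, P = cons r N₀ P₀ ∧ N = N₀.shift ∧ Q = P₀.shift := by
  induction P using bagInduction with
  | one => intro Q h; simp at h
  | cons r₀ M₀ P₀ ih =>
    intro Q h
    rw [shift_cons, cons_eq_cons] at h
    rcases h with ⟨rfl, rfl, rfl⟩ | ⟨Q₁, h, rfl⟩
    · exact ⟨M₀, P₀, rfl, rfl, rfl⟩
    · obtain ⟨N₀, P₁, rfl, rfl, rfl⟩ := ih h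
      exact ⟨N₀, cons r₀ M₀ P₁, cons_swap _ _ _ _ _, rfl, by simp⟩

end Expr

theorem bagSubst_gsub {s : Kind} (P : Bag) : ∀ S : FormalSum s,
    BagSubst 0 S P.shift (gsub P S) := by
  induction P using Expr.bagInduction with
  | one => intro S; rw [gsub_one]; exact .one S
  | cons r M P ih =>
    intro S
    rw [Expr.shift_cons, gsub_cons]
    exact .cons _ _ _ _ _ (by rw [bind_resSubst]; exact ih _)

/-- The relation `BagSubst` lists the resources in an arbitrary order, but `gsub` does not depend on
the order, so its value is the only possible result. -/
theorem BagSubst.eq_gsub {s : Kind} {S T : FormalSum s} {Q : Bag} (h : BagSubst 0 S Q T) :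
    ∀ P : Bag, P.shift = Q → T = gsub P S := by
  induction h with
  | one S =>
    intro P hP
    have : P = Expr.one := by
      induction P using Expr.bagInduction with
      | one => rfl
      | cons r M P _ => simp at hP
    simp [this]
  | cons r N Q S T _ ih =>
    intro P hP
    obtain ⟨N₀, P₀, rfl, rfl, rfl⟩ := Expr.shift_eq_cons hP
    rw [gsub_cons, ← bind_resSubst]
    exact ih P₀ rfl

theorem rootGiant_iff {R : Term} {T : FormalSum .term} :
    RootGiant R T ↔ ∃ M P, R = Expr.app (Expr.lam M) P ∧ T = giantS P {M} := by
  have e : ∀ S : FormalSum .term, S.bind Expr.zeroSubst = substS zeroSub S := fun S =>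
    Multiset.bind_congr fun A _ => A.zeroSubst_eq
  constructor
  · rintro ⟨M, P, S, rfl, h, rfl⟩
    refine ⟨M, P, rfl, ?_⟩
    rw [e, h.eq_gsub P rfl]; rfl
  · rintro ⟨M, P, rfl, rfl⟩
    exact ⟨M, P, gsub P {M}, rfl, bagSubst_gsub P _, (e _).symm⟩

/-- The giant step, defined inductively. -/
inductive GiantStep : {s : Kind} → Expr s → FormalSum s → Prop
  | beta (M : Term) (P : Bag) : GiantStep (Expr.app (Expr.lam M) P) (giantS P {M})
  | lam {M : Term} {T : FormalSum .term} : GiantStep M T → GiantStep (Expr.lam M) (lamS T)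
  | appL {M : Term} {T : FormalSum .term} (P : Bag) :
      GiantStep M T → GiantStep (Expr.app M P) (appS T {P})
  | appR {P : Bag} {T : FormalSum .bag} (M : Term) :
      GiantStep P T → GiantStep (Expr.app M P) (appS {M} T)
  | linear {M : Term} {T : FormalSum .term} (P : Bag) :
      GiantStep M T → GiantStep (Expr.cons .linear M P) (consS T {P})
  | reusable {M : Term} {T : FormalSum .term} (P : Bag) :
      GiantStep M T → GiantStep (Expr.cons .reusable M P) {bangSum T P}

theorem GiantStep.exists_giantAt {s : Kind} {A : Expr s} {T : FormalSum s}
    (h : GiantStep A T) : ∃ o, GiantAt o A T := by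
  induction h with
  | beta M P =>
    exact ⟨(.hole, _), rfl, _, rootGiant_iff.2 ⟨M, P, rfl, rfl⟩, rfl⟩
  | lam _ ih =>
    obtain ⟨⟨C, R⟩, rfl, S, hS, rfl⟩ := ih
    exact ⟨(.lam C, R), rfl, S, hS, rfl⟩
  | appL P _ ih =>
    obtain ⟨⟨C, R⟩, rfl, S, hS, rfl⟩ := ih
    exact ⟨(.appL C P, R), rfl, S, hS, appS_singleton_right _ _⟩
  | appR M _ ih =>
    obtain ⟨⟨C, R⟩, rfl, S, hS, rfl⟩ := ih
    exact ⟨(.appR M C, R), rfl, S, hS, appS_singleton_left _ _⟩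
  | linear P _ ih =>
    obtain ⟨⟨C, R⟩, rfl, S, hS, rfl⟩ := ih
    exact ⟨(.bag .linear C P, R), rfl, S, hS, consS_singleton_right _ _⟩
  | reusable P _ ih =>
    obtain ⟨⟨C, R⟩, rfl, S, hS, rfl⟩ := ih
    exact ⟨(.bag .reusable C P, R), rfl, S, hS, rfl⟩

theorem GiantStep.fill {s : Kind} (C : Ctx s) {R : Term} {S : FormalSum .term}
    (h : RootGiant R S) : GiantStep (C.fill R) (C.fillSum S) := by
  induction C with
  | hole => obtain ⟨M, P, rfl, rfl⟩ := rootGiant_iff.1 h; exact .beta M P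
  | lam C ih => exact ih.lam
  | appL C P ih => rw [Ctx.fillSum, ← appS_singleton_right]; exact ih.appL P
  | appR M C ih => rw [Ctx.fillSum, ← appS_singleton_left]; exact ih.appR M
  | bag r C P ih =>
    cases r
    · rw [Ctx.fillSum, ← consS_singleton_right]; exact ih.linear P
    · exact ih.reusable P

theorem ndStep_iff {s : Kind} {A B : Expr s} : NDStep A B ↔ ∃ T, GiantStep A T ∧ B ∈ T := by
  constructor
  · rintro ⟨⟨C, R⟩, T, U, ⟨rfl, S, hS, rfl⟩, h⟩
    exact ⟨_, GiantStep.fill C hS, by simp [h]⟩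
  · rintro ⟨T, h, hB⟩
    obtain ⟨o, ho⟩ := h.exists_giantAt
    obtain ⟨U, rfl⟩ := Multiset.exists_cons_of_mem hB
    exact ⟨o, _, U, ho, (Multiset.singleton_add _ _).symm⟩

/-- `GiantStep` has no rule for the tail of a bag: since bags are unordered, the reduced resource
can be brought to the front. For a reusable one this also moves its entire group of reducts past the
new resource. -/
theorem GiantStep.cons {P : Bag} {T : FormalSum .bag} (h : GiantStep P T) (r : Mode)
    (M : Term) : GiantStep (Expr.cons r M P) (T.map (Expr.cons r M)) := by
  obtain ⟨⟨C, R⟩, rfl, S, hS, rfl⟩ := h.exists_giantAt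
  cases C with
  | bag r' C Q =>
    have h := GiantStep.fill (C.bag r' (Expr.cons r M Q)) hS
    cases r'
    · simpa [Ctx.fill, Ctx.fillSum, Expr.cons_swap, Multiset.map_map] using h
    · simpa [Ctx.fill, Ctx.fillSum, Expr.cons_swap _ r, bangSum_cons] using h

theorem GiantStep.bangSum_tail {P : Bag} {T : FormalSum .bag} (h : GiantStep P T)
    (S : FormalSum .term) : GiantStep (bangSum S P) (bangS S T) := by
  induction S using Multiset.induction_on with
  | empty => simpa
  | cons a S ih => simpa [bangS, Multiset.map_map, Function.comp_def] using ih.cons .reusable a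

theorem bind_singleton_self {α : Type*} (S : Multiset α) : (S.bind fun a => {a}) = S := by
  simpa using Multiset.bind_singleton S id

/-! ### Reduction of sums -/

/-- A giant step in one addend of a sum. -/
inductive SumStep {s : Kind} : FormalSum s → FormalSum s → Prop
  | mk {A : Expr s} {T : FormalSum s} (U : FormalSum s) :
      GiantStep A T → SumStep (A ::ₘ U) (T + U)

/-- A step in one addend is a step inside one reusable resource of the group, whose reducts join the
group. Reduction of sums is thus exactly what is simulated under `(·)^!`. -/
theorem SumStep.bangSum {S S' : FormalSum .term} (h : SumStep S S') (P : Bag) :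
    GiantStep (bangSum S P) {ResourceCalculus.bangSum S' P} := by
  obtain ⟨V, h⟩ := h
  rw [bangSum_cons_left, bangSum_add]
  exact h.reusable _

/-- Reduction of sums by giant steps. -/
def SumRed {s : Kind} : FormalSum s → FormalSum s → Prop := ReflTransGen SumStep

namespace SumRed

variable {s t : Kind} {S S' T T' U : FormalSum s}

theorem refl (S : FormalSum s) : SumRed S S := ReflTransGen.refl

theorem trans (h : SumRed S T) (h' : SumRed T U) : SumRed S U := ReflTransGen.trans h h'

theorem of_giantStep {A : Expr s} (h : GiantStep A T) : SumRed {A} T := by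
  have := SumStep.mk 0 h
  rw [add_zero] at this
  exact .single this

theorem add_right (h : SumRed S T) (U : FormalSum s) : SumRed (S + U) (T + U) := by
  induction h with
  | refl => exact refl _
  | tail _ h ih =>
    obtain ⟨V, h⟩ := h
    refine ih.tail ?_
    rw [Multiset.cons_add, add_assoc]
    exact .mk _ h

theorem add (h : SumRed S T) (h' : SumRed S' T') : SumRed (S + S') (T + T') := by
  refine (h.add_right S').trans ?_
  rw [add_comm T, add_comm T]
  exact h'.add_right T

theorem bind_congr {α : Type*} (V : Multiset α) {f g : α → FormalSum s}
    (h : ∀ a, SumRed (f a) (g a)) : SumRed (V.bind f) (V.bind g) := by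
  induction V using Multiset.induction_on with
  | empty => exact refl _
  | cons a V ih => simpa using (h a).add ih

theorem bind {f : Expr s → FormalSum t} (hf : ∀ A T, GiantStep A T → SumRed (f A) (T.bind f))
    (h : SumRed S T) : SumRed (S.bind f) (T.bind f) := by
  induction h with
  | refl => exact refl _
  | tail _ h ih =>
    refine ih.trans ?_
    obtain ⟨V, h⟩ := h
    rw [Multiset.cons_bind, Multiset.add_bind]
    exact (hf _ _ h).add_right _

theorem lam {S T : FormalSum .term} (h : SumRed S T) : SumRed (lamS S) (lamS T) := by
  have := h.bind (f := fun M => {Expr.lam M}) fun A T h => by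
    simpa [Multiset.bind_singleton, lamS] using of_giantStep h.lam
  simpa [Multiset.bind_singleton, lamS] using this

theorem app {S S' : FormalSum .term} {T T' : FormalSum .bag} (h : SumRed S S')
    (h' : SumRed T T') : SumRed (appS S T) (appS S' T') := by
  refine SumRed.trans (T := appS S' T) ?_ ?_
  · refine h.bind (f := fun M => T.map fun P => Expr.app M P) fun A V hA => ?_
    have := bind_congr T fun P => of_giantStep (hA.appL P)
    rw [← appS_bind_right, bind_singleton_self] at this
    rw [Multiset.bind_singleton] at this
    exact this
  · refine bind_congr S' fun M => ?_
    have := h'.bind (f := fun P => {Expr.app M P}) fun A T h => by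
      simpa [Multiset.bind_singleton, appS_singleton_left] using of_giantStep (h.appR M)
    simpa [Multiset.bind_singleton] using this

theorem cons {S S' : FormalSum .term} {T T' : FormalSum .bag} (h : SumRed S S')
    (h' : SumRed T T') : SumRed (consS S T) (consS S' T') := by
  refine SumRed.trans (T := consS S' T) ?_ ?_
  · refine h.bind (f := fun M => T.map fun P => Expr.cons .linear M P) fun A V hA => ?_
    have := bind_congr T fun P => of_giantStep (hA.linear P)
    rw [← consS_bind_right, bind_singleton_self] at this
    rw [Multiset.bind_singleton] at this
    exact this
  · refine bind_congr S' fun M => ?_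
    have := h'.bind (f := fun P => {Expr.cons .linear M P}) fun A T h => by
      simpa [Multiset.bind_singleton] using of_giantStep (h.cons .linear M)
    simpa [Multiset.bind_singleton] using this

theorem bangSum_left {S S' : FormalSum .term} (h : SumRed S S') (P : Bag) :
    SumRed {bangSum S P} {bangSum S' P} := by
  induction h with
  | refl => exact refl _
  | tail _ h ih => exact ih.trans (of_giantStep (h.bangSum P))

theorem bang {S S' : FormalSum .term} {T T' : FormalSum .bag} (h : SumRed S S')
    (h' : SumRed T T') : SumRed (bangS S T) (bangS S' T') := by
  refine SumRed.trans (T := bangS S' T) ?_ ?_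
  · have := bind_congr T fun P => h.bangSum_left P
    simpa [Multiset.bind_singleton, bangS] using this
  · have := h'.bind (f := fun P => {bangSum S' P}) fun A T h => by
      simpa [Multiset.bind_singleton, bangS] using of_giantStep (h.bangSum_tail S')
    simpa [Multiset.bind_singleton, bangS] using this

end SumRed

-- Reduction of sums is stable under substitution

theorem giantS_eq_bind {s : Kind} (P : Bag) (S : FormalSum s) :
    giantS P S = S.bind fun A => giantS P {A} := by
  rw [← giantS_bind, bind_singleton_self]

theorem mem_giantS {s : Kind} {P : Bag} {S : FormalSum s} {K : Expr s} :
    K ∈ giantS P S ↔ ∃ A ∈ S, K ∈ giantS P {A} := by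
  rw [giantS_eq_bind, Multiset.mem_bind]

/-- A substitution turns a redex into a sum of redexes, each of which has to be fired; this is why
the conclusion is a many-step reduction of sums. -/
theorem GiantStep.subst {s : Kind} {A : Expr s} {T : FormalSum s} (h : GiantStep A T) :
    ∀ σ : ℕ → FormalSum .term, SumRed (A.subst σ) (substS σ T) := by
  induction h with
  | beta M P =>
    intro σ
    rw [substS_giantS, substS_singleton, Expr.subst_app, Expr.subst_lam,
      ← bind_singleton_self (P.subst σ), appS_bind_right, bind_singleton_self]
    refine SumRed.bind_congr _ fun P' => ?_
    rw [giantS_eq_bind, appS_singleton_right, lamS, Multiset.map_map,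
      ← Multiset.bind_singleton]
    exact SumRed.bind_congr _ fun M' => .of_giantStep (.beta M' P')
  | lam _ ih => intro σ; rw [Expr.subst_lam, substS_lamS]; exact (ih _).lam
  | appL P _ ih =>
    intro σ; rw [Expr.subst_app, substS_appS, substS_singleton]; exact (ih _).app (.refl _)
  | appR M _ ih =>
    intro σ; rw [Expr.subst_app, substS_appS, substS_singleton]
    exact SumRed.app (.refl _) (ih _)
  | linear P _ ih =>
    intro σ; rw [Expr.subst_linear, substS_consS, substS_singleton]
    exact (ih _).cons (.refl _)
  | reusable P _ ih =>
    intro σ; rw [Expr.subst_reusable, substS_singleton, subst_bangSum]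
    exact (ih _).bang (.refl _)

theorem SumRed.subst {s : Kind} {S T : FormalSum s} (h : SumRed S T)
    (σ : ℕ → FormalSum .term) : SumRed (substS σ S) (substS σ T) :=
  h.bind fun _ _ h => h.subst σ

theorem SumRed.map_rename {s : Kind} {S T : FormalSum s} (h : SumRed S T) (ρ : ℕ → ℕ) :
    SumRed (S.map (Expr.rename ρ)) (T.map (Expr.rename ρ)) := by
  have := h.subst fun n => {Expr.var (ρ n)}
  simpa [substS, Expr.subst_var_comp, Multiset.bind_singleton] using this

theorem sumRed_liftSub {σ σ' : ℕ → FormalSum .term} (h : ∀ n, SumRed (σ n) (σ' n)) :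
    ∀ n, SumRed (liftSub σ n) (liftSub σ' n)
  | 0 => .refl _
  | n + 1 => (h n).map_rename _

theorem Expr.subst_sumRed {s : Kind} (A : Expr s) : ∀ {σ σ' : ℕ → FormalSum .term},
    (∀ n, SumRed (σ n) (σ' n)) → SumRed (A.subst σ) (A.subst σ') := by
  induction A using Expr.induction with
  | var n => intro σ σ' h; exact h n
  | lam M ih =>
    intro σ σ' h; rw [subst_lam, subst_lam]; exact (ih (sumRed_liftSub h)).lam
  | app M P ih ih' => intro σ σ' h; rw [subst_app, subst_app]; exact (ih h).app (ih' h)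
  | one => intro σ σ' h; exact .refl _
  | cons r M P ih ih' =>
    intro σ σ' h
    cases r
    · rw [subst_linear, subst_linear]; exact (ih h).cons (ih' h)
    · rw [subst_reusable, subst_reusable]; exact (ih h).bang (ih' h)

theorem SumRed.substS_congr {s : Kind} {S T : FormalSum s} (h : SumRed S T)
    {σ σ' : ℕ → FormalSum .term} (hσ : ∀ n, SumRed (σ n) (σ' n)) :
    SumRed (substS σ S) (substS σ' T) :=
  (h.subst σ).trans (SumRed.bind_congr T fun A => A.subst_sumRed hσ)

/-! ### Weak head reduction -/

/-- One step of weak head reduction. -/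
inductive WeakHead : Term → Term → Prop
  | beta {M R : Term} {P : Bag} : R ∈ giantS P {M} → WeakHead (Expr.app (Expr.lam M) P) R
  | app {M M' : Term} (P : Bag) : WeakHead M M' → WeakHead (Expr.app M P) (Expr.app M' P)

/-- Giant steps commute with substitution, so an addend of the substituted reduct already occurs in
the giant step of some addend of the substituted redex. The step is traced backwards, from the
chosen result to its ancestor. -/
theorem WeakHead.subst {M M' : Term} (h : WeakHead M M') (σ : ℕ → FormalSum .term) :
    ∀ {K'}, K' ∈ M'.subst σ → ∃ K ∈ M.subst σ, WeakHead K K' := by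
  induction h with
  | @beta M R P hR =>
    intro K' hK'
    have h : K' ∈ substS σ (giantS P {M}) := (mem_substS σ).2 ⟨R, hR, hK'⟩
    rw [substS_giantS, Multiset.mem_bind] at h
    obtain ⟨P', hP', h⟩ := h
    obtain ⟨M', hM', h⟩ := mem_giantS.1 h
    rw [substS_singleton] at hM'
    refine ⟨Expr.app (Expr.lam M') P', ?_, .beta h⟩
    rw [Expr.subst_app, mem_appS]
    exact ⟨_, by simpa [mem_lamS] using hM', P', hP', rfl⟩
  | app P _ ih =>
    intro K' hK'
    rw [Expr.subst_app, mem_appS] at hK'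
    obtain ⟨M₁, hM₁, P₁, hP₁, rfl⟩ := hK'
    obtain ⟨K, hK, h⟩ := ih hM₁
    exact ⟨Expr.app K P₁, by rw [Expr.subst_app, mem_appS]; exact ⟨K, hK, P₁, hP₁, rfl⟩,
      h.app P₁⟩

/-- As for substitution, with the Leibniz rule `dsubstS_giantS` telling whether the ancestor
received the linear copy in its body or in its bag. -/
theorem WeakHead.linSubst {M M' : Term} (h : WeakHead M M') (x : ℕ) (N : Term) :
    ∀ {K'}, K' ∈ M'.linSubst x N → ∃ K ∈ M.linSubst x N, WeakHead K K' := by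
  induction h with
  | @beta M R P hR =>
    intro K' hK'
    have h : K' ∈ dsubstS idSub (singleDir x {N}) (giantS P {M}) :=
      Multiset.mem_bind.2 ⟨R, hR, by rwa [← Expr.linSubst_eq_dsubst]⟩
    rw [dsubstS_giantS, Multiset.mem_add, dsubstS_singleton, ← Expr.linSubst_eq_dsubst] at h
    rw [Expr.linSubst_app, Expr.linSubst_lam]
    rcases h with h | h
    · obtain ⟨M', hM', h⟩ := mem_giantS.1 h
      exact ⟨Expr.app (Expr.lam M') P, by simpa [mem_appS, mem_lamS] using .inl hM', .beta h⟩
    · obtain ⟨P', hP', h⟩ := Multiset.mem_bind.1 h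
      exact ⟨Expr.app (Expr.lam M) P', by simpa [mem_appS, mem_lamS] using .inr hP', .beta h⟩
  | @app M M' P h ih =>
    intro K' hK'
    rw [Expr.linSubst_app, Multiset.mem_add] at hK'
    rw [Expr.linSubst_app]
    rcases hK' with hK' | hK'
    · rw [appS_singleton_right, Multiset.mem_map] at hK'
      obtain ⟨M₁, hM₁, rfl⟩ := hK'
      obtain ⟨K, hK, h⟩ := ih hM₁
      exact ⟨Expr.app K P, by simpa [mem_appS] using .inl hK, h.app P⟩
    · rw [appS_singleton_left, Multiset.mem_map] at hK'
      obtain ⟨P₁, hP₁, rfl⟩ := hK'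
      exact ⟨Expr.app M P₁, by simpa [mem_appS] using .inr hP₁, h.app P₁⟩

theorem WeakHead.rename {M M' : Term} (h : WeakHead M M') (ρ : ℕ → ℕ) :
    WeakHead (M.rename ρ) (M'.rename ρ) := by
  obtain ⟨K, hK, h⟩ := h.subst (fun n => {Expr.var (ρ n)}) (K' := M'.rename ρ)
    (by simp [Expr.subst_var_comp])
  rw [Expr.subst_var_comp, Multiset.mem_singleton] at hK
  exact hK ▸ h

theorem weakHead_star_app {M M' : Term}
    (h : ReflTransGen WeakHead M M') (P : Bag) :
    ReflTransGen WeakHead (Expr.app M P) (Expr.app M' P) := by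
  induction h with
  | refl => exact .refl
  | tail _ h ih => exact ih.tail (h.app P)

/-- A relation to sums that commutes with weak head steps commutes with weak head reduction. -/
theorem weakHead_star_lift {f : Term → FormalSum .term}
    (hf : ∀ {M M'}, WeakHead M M' → ∀ {K'}, K' ∈ f M' → ∃ K ∈ f M, WeakHead K K')
    {M M' : Term} (h : ReflTransGen WeakHead M M') :
    ∀ {K'}, K' ∈ f M' → ∃ K ∈ f M, ReflTransGen WeakHead K K' := by
  induction h with
  | refl => exact fun hK' => ⟨_, hK', .refl⟩
  | tail _ h ih =>
    intro K' hK'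
    obtain ⟨K₁, hK₁, h₁⟩ := hf h hK'
    obtain ⟨K, hK, h₀⟩ := ih hK₁
    exact ⟨K, hK, h₀.tail h₁⟩

/-! ### Standard reductions -/

/-- Standard reductions: weak head reduction, followed by standard reductions of the immediate
subexpressions. Sums of reusable resources are reduced by arbitrary giant steps, subject to the
condition that every addend of the result is reached by a standard reduction, too. -/
inductive Standard : {s : Kind} → Expr s → Expr s → Prop
  | var {M : Term} {n : ℕ} : ReflTransGen WeakHead M (Expr.var n) → Standard M (Expr.var n)
  | lam {M A A' : Term} :
      ReflTransGen WeakHead M (Expr.lam A) → Standard A A' → Standard M (Expr.lam A')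
  | app {M A A' : Term} {P P' : Bag} : ReflTransGen WeakHead M (Expr.app A P) →
      Standard A A' → Standard P P' → Standard M (Expr.app A' P')
  | one : Standard Expr.one Expr.one
  | linear {M M' : Term} {P P' : Bag} : Standard M M' → Standard P P' →
      Standard (Expr.cons .linear M P) (Expr.cons .linear M' P')
  | reusable {U T : FormalSum .term} {P P' : Bag} (f : Term → Term) : SumRed U T →
      (∀ N ∈ T, f N ∈ U) → (∀ N ∈ T, Standard (f N) N) → Standard P P' →
      Standard (bangSum U P) (bangSum T P')

namespace Standard

/-- Choice supplies the ancestor function that `Standard.reusable` requires. -/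
theorem bang {U T : FormalSum .term} {P P' : Bag} (h : SumRed U T)
    (hf : ∀ N ∈ T, ∃ M ∈ U, Standard M N) (hP : Standard P P') :
    Standard (bangSum U P) (bangSum T P') := by
  have : Inhabited Term := ⟨Expr.var 0⟩
  choose! f hf hf' using hf
  exact .reusable f h hf hf' hP

theorem refl {s : Kind} (A : Expr s) : Standard A A := by
  induction A using Expr.induction with
  | var n => exact .var .refl
  | lam M ih => exact .lam .refl ih
  | app M P ih ih' => exact .app .refl ih ih'
  | one => exact .one
  | cons r M P ih ih' =>
    cases r
    · exact .linear ih ih'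
    · simpa using bang (U := {M}) (T := {M}) (.refl _) (by simpa using ih) ih'

theorem expand {M M₁ N : Term} (h : ReflTransGen WeakHead M M₁) (h₁ : Standard M₁ N) :
    Standard M N := by
  cases h₁ with
  | var h' => exact .var (h.trans h')
  | lam h' hA => exact .lam (h.trans h') hA
  | app h' hA hP => exact .app (h.trans h') hA hP

theorem lam_inv {M A' : Term} (h : Standard M (Expr.lam A')) :
    ∃ A, ReflTransGen WeakHead M (Expr.lam A) ∧ Standard A A' := by
  generalize e : Expr.lam A' = N at h
  cases h with
  | var h => simp at e
  | lam h hA => rw [Expr.lam_inj] at e; exact ⟨_, h, e ▸ hA⟩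
  | app h hA hP => simp at e

theorem app_inv {M A' : Term} {P' : Bag} (h : Standard M (Expr.app A' P')) :
    ∃ A P, ReflTransGen WeakHead M (Expr.app A P) ∧ Standard A A' ∧ Standard P P' := by
  generalize e : Expr.app A' P' = N at h
  cases h with
  | var h => simp at e
  | lam h hA => simp at e
  | app h hA hP =>
    rw [Expr.app_inj] at e
    obtain ⟨rfl, rfl⟩ := e
    exact ⟨_, _, h, hA, hP⟩

/-- The given resource need not be the outermost one in the derivation, so it is searched for by
induction and brought to the front. The `match` on the kind lets the induction run over both sorts.
-/
theorem linear_inv {s : Kind} {A B : Expr s} (h : Standard A B) : match s with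
    | .term => True
    | .bag => ∀ M' Q, B = Expr.cons .linear M' Q →
      ∃ M P, A = Expr.cons .linear M P ∧ Standard M M' ∧ Standard P Q := by
  induction h with
  | var | lam | app => trivial
  | one => intro M' Q h; simp at h
  | @linear M₀ M₀' P₀ P₀' hM hP _ ih =>
    intro M' Q h
    rw [Expr.cons_eq_cons] at h
    rcases h with ⟨-, rfl, rfl⟩ | ⟨Q₁, rfl, rfl⟩
    · exact ⟨M₀, P₀, rfl, hM, hP⟩
    · obtain ⟨M, P, rfl, hM', hP'⟩ := ih _ _ rfl
      exact ⟨M, Expr.cons .linear M₀ P, Expr.cons_swap _ _ _ _ _, hM', .linear hM hP'⟩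
  | @reusable U T P₀ P₀' f hUT hf hf' hP _ ih =>
    intro M' Q h
    obtain ⟨Q', rfl, rfl⟩ := bangSum_eq_linear h
    obtain ⟨M, P, rfl, hM', hP'⟩ := ih _ _ rfl
    exact ⟨M, bangSum U P, bangSum_cons _ _ _ _, hM', .reusable f hUT hf hf' hP'⟩

/-- A reusable resource is recovered together with the group it belongs to, because its ancestor may
be shared with the other members `T` of that group. -/
theorem reusable_inv {s : Kind} {A B : Expr s} (h : Standard A B) : match s with
    | .term => True
    | .bag => ∀ M' Q, B = Expr.cons .reusable M' Q →
      ∃ U T P P', A = bangSum U P ∧ Q = bangSum T P' ∧ SumRed U (M' ::ₘ T) ∧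
        (∀ N ∈ M' ::ₘ T, ∃ M ∈ U, Standard M N) ∧ Standard P P' := by
  induction h with
  | var | lam | app => trivial
  | one => intro M' Q h; simp at h
  | @linear M₀ M₀' P₀ P₀' hM hP _ ih =>
    intro M' Q h
    rw [Expr.cons_eq_cons] at h
    rcases h with ⟨h, -⟩ | ⟨Q₁, rfl, rfl⟩
    · cases h
    · obtain ⟨U, T, P, P', rfl, rfl, h₁, h₂, h₃⟩ := ih _ _ rfl
      exact ⟨U, T, Expr.cons .linear M₀ P, Expr.cons .linear M₀' P',
        (bangSum_cons _ _ _ _).symm, (bangSum_cons _ _ _ _).symm, h₁, h₂, .linear hM h₃⟩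
  | @reusable U T P₀ P₀' f hUT hf hf' hP _ ih =>
    intro M' Q h
    rcases bangSum_eq_reusable h with ⟨T', rfl, rfl⟩ | ⟨Q', rfl, rfl⟩
    · exact ⟨U, T', P₀, P₀', rfl, rfl, hUT, fun N hN => ⟨f N, hf N hN, hf' N hN⟩, hP⟩
    · obtain ⟨U', T', P, P', rfl, rfl, h₁, h₂, h₃⟩ := ih _ _ rfl
      exact ⟨U', T', bangSum U P, bangSum T P', bangSum_comm _ _ _, bangSum_comm _ _ _, h₁, h₂,
        .reusable f hUT hf hf' h₃⟩

theorem rename {s : Kind} {A A' : Expr s} (h : Standard A A') :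
    ∀ ρ : ℕ → ℕ, Standard (A.rename ρ) (A'.rename ρ) := by
  have star : ∀ {M M' : Term} (ρ : ℕ → ℕ), ReflTransGen WeakHead M M' →
      ReflTransGen WeakHead (M.rename ρ) (M'.rename ρ) := fun ρ h => by
    induction h with
    | refl => exact .refl
    | tail _ h ih => exact ih.tail (h.rename ρ)
  induction h with
  | var h => exact fun ρ => .var (star ρ h)
  | lam h _ ih =>
    intro ρ; rw [Expr.rename_lam]; exact .lam (by simpa using star ρ h) (ih _)
  | app h _ _ ih ih' =>
    intro ρ; rw [Expr.rename_app]; exact .app (by simpa using star ρ h) (ih _) (ih' _)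
  | one => intro ρ; exact .one
  | linear _ _ ih ih' =>
    intro ρ; rw [Expr.rename_cons, Expr.rename_cons]; exact .linear (ih ρ) (ih' ρ)
  | reusable f h hf _ _ ih ih' =>
    intro ρ
    rw [rename_bangSum, rename_bangSum]
    refine bang (h.map_rename ρ) (fun N hN => ?_) (ih' ρ)
    obtain ⟨N, hN', rfl⟩ := Multiset.mem_map.1 hN
    exact ⟨_, Multiset.mem_map_of_mem _ (hf N hN'), ih N hN' ρ⟩

/-- Weak head prefixes are pulled back along linear substitution. In a reusable group the derivative
takes a linear copy of one member; the copy's ancestor is taken from the ancestor group, and the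
groups themselves stay as they were. -/
theorem dsubst {s : Kind} {A A' : Expr s} (h : Standard A A') :
    ∀ (x : ℕ) {N N' : Term}, Standard N N' → ∀ K' ∈ A'.dsubst idSub (singleDir x {N'}),
      ∃ K ∈ A.dsubst idSub (singleDir x {N}), Standard K K' := by
  have star : ∀ {M M' : Term} (x : ℕ) (N : Term), ReflTransGen WeakHead M M' →
      ∀ {K'}, K' ∈ M'.dsubst idSub (singleDir x {N}) →
        ∃ K ∈ M.dsubst idSub (singleDir x {N}), ReflTransGen WeakHead K K' := fun x N =>
    weakHead_star_lift fun h => by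
      simp only [← Expr.linSubst_eq_dsubst]; exact h.linSubst x N
  have ofHead : ∀ {M M' K' : Term} (x : ℕ) (N : Term), ReflTransGen WeakHead M M' →
      (∃ K ∈ M'.dsubst idSub (singleDir x {N}), Standard K K') →
        ∃ K ∈ M.dsubst idSub (singleDir x {N}), Standard K K' := fun x N h ⟨K, hK, h'⟩ => by
    obtain ⟨K₀, hK₀, h₀⟩ := star x N h hK
    exact ⟨K₀, hK₀, h'.expand h₀⟩
  induction h with
  | @var M n h =>
    intro x N N' hN K' hK'
    refine ofHead x N h ?_
    simp only [Expr.dsubst_var, singleDir] at hK' ⊢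
    split at hK'
    · rw [Multiset.mem_singleton] at hK'
      exact ⟨N, by simp [*], hK' ▸ hN⟩
    · simp at hK'
  | lam h _ ih =>
    intro x N N' hN K' hK'
    refine ofHead x N h ?_
    simp only [Expr.dsubst_lam, liftSub_idSub, liftDir_singleDir, Multiset.map_singleton,
      mem_lamS] at hK' ⊢
    obtain ⟨K₁, hK₁, rfl⟩ := hK'
    obtain ⟨K, hK, h'⟩ := ih (x + 1) (hN.rename _) K₁ hK₁
    exact ⟨_, ⟨K, hK, rfl⟩, .lam .refl h'⟩
  | @app M A A' P P' h hA hP ih ih' =>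
    intro x N N' hN K' hK'
    refine ofHead x N h ?_
    simp only [Expr.dsubst_app, Expr.subst_idSub, Multiset.mem_add, mem_appS,
      Multiset.mem_singleton, exists_eq_left] at hK' ⊢
    rcases hK' with ⟨K₁, hK₁, rfl⟩ | ⟨K₁, hK₁, rfl⟩
    · obtain ⟨K, hK, h'⟩ := ih x hN K₁ hK₁
      exact ⟨_, .inl ⟨K, hK, rfl⟩, .app .refl h' hP⟩
    · obtain ⟨K, hK, h'⟩ := ih' x hN K₁ hK₁
      exact ⟨_, .inr ⟨K, hK, rfl⟩, .app .refl hA h'⟩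
  | one => intro x N N' hN K' hK'; simp at hK'
  | linear hM hP ih ih' =>
    intro x N N' hN K' hK'
    simp only [Expr.dsubst_linear, Expr.subst_idSub, Multiset.mem_add, mem_consS,
      Multiset.mem_singleton, exists_eq_left] at hK' ⊢
    rcases hK' with ⟨K₁, hK₁, rfl⟩ | ⟨K₁, hK₁, rfl⟩
    · obtain ⟨K, hK, h'⟩ := ih x hN K₁ hK₁
      exact ⟨_, .inl ⟨K, hK, rfl⟩, .linear h' hP⟩
    · obtain ⟨K, hK, h'⟩ := ih' x hN K₁ hK₁
      exact ⟨_, .inr ⟨K, hK, rfl⟩, .linear hM h'⟩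
  | reusable f h hf hf' hP ih ih' =>
    intro x N N' hN K' hK'
    simp only [dsubst_bangSum, substS_idSub, Expr.subst_idSub, bangS_singleton,
      Multiset.mem_add, mem_consS, mem_bangS, Multiset.mem_singleton, exists_eq_left] at hK' ⊢
    rcases hK' with ⟨K₁, hK₁, rfl⟩ | ⟨K₁, hK₁, rfl⟩
    · obtain ⟨M', hM', hK₁⟩ := Multiset.mem_bind.1 hK₁
      obtain ⟨K, hK, h'⟩ := ih M' hM' x hN K₁ hK₁
      exact ⟨_, .inl ⟨K, Multiset.mem_bind.2 ⟨_, hf M' hM', hK⟩, rfl⟩,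
        .linear h' (.reusable f h hf hf' hP)⟩
    · obtain ⟨K, hK, h'⟩ := ih' x hN K₁ hK₁
      exact ⟨_, .inr ⟨K, hK, rfl⟩, .reusable f h hf hf' h'⟩

/-- The two conditions on `σ` and `σ'` mirror the two premises of `Standard.reusable`: ancestors are
needed for variables in linear position, reduction of the whole sums for those under `(·)^!`. -/
theorem subst {s : Kind} {A A' : Expr s} (h : Standard A A') :
    ∀ {σ σ' : ℕ → FormalSum .term}, (∀ n, SumRed (σ n) (σ' n)) →
      (∀ n, ∀ K' ∈ σ' n, ∃ K ∈ σ n, Standard K K') →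
      ∀ K' ∈ A'.subst σ', ∃ K ∈ A.subst σ, Standard K K' := by
  have ofHead : ∀ {M M' K' : Term} (σ : ℕ → FormalSum .term), ReflTransGen WeakHead M M' →
      (∃ K ∈ M'.subst σ, Standard K K') → ∃ K ∈ M.subst σ, Standard K K' :=
    fun σ h ⟨K, hK, h'⟩ => by
      obtain ⟨K₀, hK₀, h₀⟩ := weakHead_star_lift (f := Expr.subst σ) (fun h => h.subst σ) h hK
      exact ⟨K₀, hK₀, h'.expand h₀⟩
  induction h with
  | @var M n h => exact fun hσ hσ' K' hK' => ofHead _ h (hσ' n K' hK')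
  | lam h _ ih =>
    intro σ σ' hσ hσ' K' hK'
    refine ofHead σ h ?_
    simp only [Expr.subst_lam, mem_lamS] at hK' ⊢
    obtain ⟨K₁, hK₁, rfl⟩ := hK'
    obtain ⟨K, hK, h'⟩ := ih (sumRed_liftSub hσ) (fun n K' hK' => by
      cases n with
      | zero => exact ⟨K', hK', refl K'⟩
      | succ n =>
        obtain ⟨K₂, hK₂, rfl⟩ := Multiset.mem_map.1 hK'
        obtain ⟨K, hK, h⟩ := hσ' n K₂ hK₂
        exact ⟨_, Multiset.mem_map_of_mem _ hK, h.rename _⟩) K₁ hK₁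
    exact ⟨_, ⟨K, hK, rfl⟩, .lam .refl h'⟩
  | app h hA hP ih ih' =>
    intro σ σ' hσ hσ' K' hK'
    refine ofHead σ h ?_
    simp only [Expr.subst_app, mem_appS] at hK' ⊢
    obtain ⟨K₁, hK₁, P₁, hP₁, rfl⟩ := hK'
    obtain ⟨K, hK, h'⟩ := ih hσ hσ' K₁ hK₁
    obtain ⟨P, hP, h''⟩ := ih' hσ hσ' P₁ hP₁
    exact ⟨_, ⟨K, hK, P, hP, rfl⟩, .app .refl h' h''⟩
  | one => exact fun _ _ K' hK' => ⟨K', hK', refl _⟩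
  | linear hM hP ih ih' =>
    intro σ σ' hσ hσ' K' hK'
    simp only [Expr.subst_linear, mem_consS] at hK' ⊢
    obtain ⟨K₁, hK₁, P₁, hP₁, rfl⟩ := hK'
    obtain ⟨K, hK, h'⟩ := ih hσ hσ' K₁ hK₁
    obtain ⟨P, hP, h''⟩ := ih' hσ hσ' P₁ hP₁
    exact ⟨_, ⟨K, hK, P, hP, rfl⟩, .linear h' h''⟩
  | reusable f h hf hf' hP ih ih' =>
    intro σ σ' hσ hσ' K' hK'
    simp only [subst_bangSum, mem_bangS] at hK' ⊢
    obtain ⟨P₁, hP₁, rfl⟩ := hK'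
    obtain ⟨P, hP, h''⟩ := ih' hσ hσ' P₁ hP₁
    refine ⟨_, ⟨P, hP, rfl⟩, bang (h.substS_congr hσ) (fun K' hK' => ?_) h''⟩
    obtain ⟨M', hM', hK'⟩ := (mem_substS _).1 hK'
    obtain ⟨K, hK, h'⟩ := ih M' hM' hσ hσ' K' hK'
    exact ⟨K, (mem_substS _).2 ⟨_, hf M' hM', hK⟩, h'⟩

theorem gsub {s t : Kind} {P P' : Expr s} (h : Standard P P') : match s with
    | .term => True
    | .bag => ∀ {S S' : FormalSum t}, (∀ K' ∈ S', ∃ K ∈ S, Standard K K') →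
      ∀ K' ∈ ResourceCalculus.gsub P' S', ∃ K ∈ ResourceCalculus.gsub P S, Standard K K' := by
  induction h with
  | var | lam | app => trivial
  | one => intro S S' h; simpa using h
  | linear hM _ _ ih =>
    intro S S' h
    simp only [gsub_cons]
    refine ih fun K' hK' => ?_
    obtain ⟨A', hA', hK'⟩ := Multiset.mem_bind.1 hK'
    obtain ⟨A, hA, hAA⟩ := h A' hA'
    obtain ⟨K, hK, h'⟩ := hAA.dsubst 0 (hM.rename _) K' hK'
    exact ⟨K, Multiset.mem_bind.2 ⟨A, hA, hK⟩, h'⟩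
  | @reusable U T P P' f hUT hf hf' _ _ ih =>
    intro S S' h
    simp only [gsub_bangSum]
    refine ih fun K' hK' => ?_
    obtain ⟨A', hA', hK'⟩ := Multiset.mem_bind.1 hK'
    obtain ⟨A, hA, hAA⟩ := h A' hA'
    -- The group is substituted at once. Its ancestor function handles the new addends, and the
    -- retained bound variable is its own ancestor.
    obtain ⟨K, hK, h'⟩ := hAA.subst (σ := addSub (U.map Expr.shift)) (fun n => by
      cases n with
      | zero => exact (hUT.map_rename _).add_right _
      | succ n => exact .refl _) (fun n K' hK' => by
      cases n with
      | zero =>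
        simp only [addSub, Multiset.mem_add, Multiset.mem_map, Multiset.mem_singleton] at hK' ⊢
        rcases hK' with ⟨N, hN, rfl⟩ | rfl
        · exact ⟨_, .inl ⟨f N, hf N hN, rfl⟩, (hf' N hN).rename _⟩
        · exact ⟨_, .inr rfl, refl _⟩
      | succ n => exact ⟨K', hK', refl K'⟩) K' hK'
    exact ⟨K, Multiset.mem_bind.2 ⟨A, hA, hK⟩, h'⟩

theorem giantS {s : Kind} {P P' : Bag} {A A' : Expr s} (h : Standard P P')
    (hA : Standard A A') {K' : Expr s} (hK' : K' ∈ ResourceCalculus.giantS P' {A'}) :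
    ∃ K ∈ ResourceCalculus.giantS P {A}, Standard K K' := by
  obtain ⟨B', hB', hK'⟩ := (mem_substS _).1 hK'
  obtain ⟨B, hB, hBB⟩ := gsub h (S := {A}) (S' := {A'}) (by simpa using hA) B' hB'
  obtain ⟨K, hK, h'⟩ := hBB.subst (σ := zeroSub) (fun n => .refl _)
    (fun n K' hK' => ⟨K', hK', refl K'⟩) K' hK'
  exact ⟨K, (mem_substS _).2 ⟨B, hB, hK⟩, h'⟩

/-- The absorption step of standardization. A new root redex is a descendant of `(λx.M)P` reached by
weak head reduction, so it can be fired there as one more weak head step. All addends of `T` are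
covered simultaneously, since under `(·)^!` all of them survive. -/
theorem giantStep {s : Kind} {B : Expr s} {T : FormalSum s} (h : GiantStep B T) :
    ∀ {A}, Standard A B → ∀ C ∈ T, Standard A C := by
  induction h with
  | beta M' P' =>
    intro A hA C hC
    obtain ⟨A₁, P, h, hA₁, hP⟩ := hA.app_inv
    obtain ⟨M, h', hM⟩ := hA₁.lam_inv
    obtain ⟨R, hR, hRC⟩ := hP.giantS hM hC
    exact hRC.expand ((h.trans (weakHead_star_app h' P)).tail (.beta hR))
  | lam _ ih =>
    intro A hA C hC
    obtain ⟨C, hC', rfl⟩ := (mem_lamS _).1 hC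
    obtain ⟨A₁, h, hA₁⟩ := hA.lam_inv
    exact .lam h (ih hA₁ C hC')
  | appL P _ ih =>
    intro A hA C hC
    obtain ⟨C, hC', P, hP', rfl⟩ := (mem_appS _ _).1 hC
    rw [Multiset.mem_singleton] at hP'
    obtain ⟨A₁, P₁, h, hA₁, hP₁⟩ := hA.app_inv
    exact .app h (ih hA₁ C hC') (hP' ▸ hP₁)
  | appR M _ ih =>
    intro A hA C hC
    obtain ⟨C, hC', P, hP', rfl⟩ := (mem_appS _ _).1 hC
    rw [Multiset.mem_singleton] at hC'
    obtain ⟨A₁, P₁, h, hA₁, hP₁⟩ := hA.app_inv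
    exact .app h (hC' ▸ hA₁) (ih hP₁ P hP')
  | linear P _ ih =>
    intro A hA C hC
    obtain ⟨C, hC', P, hP', rfl⟩ := (mem_consS _ _).1 hC
    rw [Multiset.mem_singleton] at hP'
    obtain ⟨M, P₁, rfl, hM, hP₁⟩ := hA.linear_inv _ _ rfl
    exact .linear (ih hM C hC') (hP' ▸ hP₁)
  | @reusable M T P hT ih =>
    intro A hA C hC
    rw [Multiset.mem_singleton] at hC
    obtain ⟨U, V, Q, Q', rfl, rfl, hU, hV, hQ⟩ := hA.reusable_inv _ _ rfl
    rw [hC, ← bangSum_add]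
    -- The addends of the result `T` inherit the ancestor of `M`; the rest of the group keeps its
    -- own.
    refine bang (hU.tail (.mk V hT)) (fun N hN => ?_) hQ
    rcases Multiset.mem_add.1 hN with hN | hN
    · obtain ⟨M₀, hM₀, h⟩ := hV M (Multiset.mem_cons_self _ _)
      exact ⟨M₀, hM₀, ih h N hN⟩
    · exact hV N (Multiset.mem_cons_of_mem hN)

theorem of_ndStep_star {s : Kind} {A B : Expr s} (h : ReflTransGen NDStep A B) :
    Standard A B := by
  induction h with
  | refl => exact refl _
  | tail _ h ih =>
    obtain ⟨T, hT, hB⟩ := ndStep_iff.1 h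
    exact giantStep hT ih _ hB

end Standard

/-! ### Outer normal forms -/

theorem isOnf_var (n : ℕ) : IsOnf (Expr.var n) := by
  rintro C R - ⟨M, P, rfl⟩ h
  cases C <;> simp [Ctx.fill] at h

theorem isOnf_one : IsOnf Expr.one := by
  rintro C R - - h
  cases C; simp [Ctx.fill] at h

theorem isOnf_lam {M : Term} : IsOnf (Expr.lam M) ↔ IsOnf M := by
  constructor
  · rintro h C R hC hR rfl
    exact h (.lam C) R hC hR rfl
  · rintro h C R hC ⟨L, P, rfl⟩ e
    cases C with
    | lam C => exact h C _ hC ⟨L, P, rfl⟩ (by simpa [Ctx.fill] using e)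
    | _ => simp [Ctx.fill] at e

theorem isOnf_app {M : Term} {P : Bag} :
    IsOnf (Expr.app M P) ↔ (∀ L, M ≠ Expr.lam L) ∧ IsOnf M ∧ IsOnf P := by
  constructor
  · intro h
    refine ⟨?_, ?_, ?_⟩
    · rintro L rfl
      exact h .hole _ trivial ⟨L, P, rfl⟩ rfl
    · rintro C R hC hR rfl
      exact h (.appL C P) R hC hR rfl
    · rintro C R hC hR rfl
      exact h (.appR M C) R hC hR rfl
  · rintro ⟨h₁, h₂, h₃⟩ C R hC ⟨L, Q, rfl⟩ e
    cases C with
    | hole => exact h₁ L (Expr.app_inj.1 e).1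
    | lam C => simp [Ctx.fill] at e
    | appL C P' => exact h₂ C _ hC ⟨L, Q, rfl⟩ (Expr.app_inj.1 e).1
    | appR M' C => exact h₃ C _ hC ⟨L, Q, rfl⟩ (Expr.app_inj.1 e).2

theorem IsOnf.tail {r : Mode} {M : Term} {P : Bag} (h : IsOnf (Expr.cons r M P)) :
    IsOnf P := by
  rintro C R hC hR rfl
  cases C with
  | bag r' C Q =>
    cases r'
    · exact h (.bag .linear C (Expr.cons r M Q)) R hC hR (Expr.cons_swap _ _ _ _ _)
    · exact hC.elim

theorem isOnf_linear {M : Term} {P : Bag} :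
    IsOnf (Expr.cons .linear M P) ↔ IsOnf M ∧ IsOnf P := by
  constructor
  · intro h
    refine ⟨?_, h.tail⟩
    rintro C R hC hR rfl
    exact h (.bag .linear C P) R hC hR rfl
  · rintro ⟨h₁, h₂⟩ C R hC hR e
    cases C with
    | bag r C Q =>
      cases r
      · rcases Expr.cons_eq_cons.1 e with ⟨-, rfl, -⟩ | ⟨Q', rfl, -⟩
        · exact h₁ C R hC hR rfl
        · exact h₂ (.bag .linear C Q') R hC hR rfl
      · exact hC

theorem isOnf_reusable {M : Term} {P : Bag} : IsOnf (Expr.cons .reusable M P) ↔ IsOnf P := by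
  refine ⟨IsOnf.tail, fun h C R hC hR e => ?_⟩
  cases C with
  | bag r C Q =>
    cases r
    · rcases Expr.cons_eq_cons.1 e with ⟨e, -⟩ | ⟨Q', rfl, -⟩
      · cases e
      · exact h (.bag .linear C Q') R hC hR rfl
    · exact hC

theorem isOnf_bangSum {S : FormalSum .term} {P : Bag} : IsOnf (bangSum S P) ↔ IsOnf P := by
  induction S using Multiset.induction_on with
  | empty => simp
  | cons a S ih => rw [bangSum_cons_left, isOnf_reusable, ih]

/-- Only firing a root redex could create an abstraction, and an onf is not a redex. -/
theorem GiantStep.ne_lam {M : Term} {T : FormalSum .term} (h : GiantStep M T)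
    (hM : ∀ L, M ≠ Expr.lam L) (hM' : IsOnf M) : ∀ B ∈ T, ∀ L, B ≠ Expr.lam L := by
  cases h with
  | beta M P => exact absurd rfl ((isOnf_app.1 hM').1 M)
  | lam h => exact absurd rfl (hM _)
  | appL P h => rintro B hB L rfl; simp [mem_appS] at hB
  | appR M h => rintro B hB L rfl; simp [mem_appS] at hB

/-- The redexes of an onf lie under some `(·)^!`, and changing reusable resources cannot create a
redex outside of them. -/
theorem IsOnf.giantStep {s : Kind} {A : Expr s} {T : FormalSum s} (h : GiantStep A T) :
    IsOnf A → ∀ B ∈ T, IsOnf B := by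
  induction h with
  | beta M P => exact fun hA => absurd rfl ((isOnf_app.1 hA).1 M)
  | lam _ ih =>
    intro hA B hB
    obtain ⟨B, hB', rfl⟩ := (mem_lamS _).1 hB
    exact isOnf_lam.2 (ih (isOnf_lam.1 hA) B hB')
  | appL P h ih =>
    intro hA B hB
    obtain ⟨h₁, h₂, h₃⟩ := isOnf_app.1 hA
    rw [appS_singleton_right] at hB
    obtain ⟨B, hB', rfl⟩ := Multiset.mem_map.1 hB
    exact isOnf_app.2 ⟨h.ne_lam h₁ h₂ B hB', ih h₂ B hB', h₃⟩
  | appR M h ih =>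
    intro hA B hB
    obtain ⟨h₁, h₂, h₃⟩ := isOnf_app.1 hA
    rw [appS_singleton_left] at hB
    obtain ⟨B, hB', rfl⟩ := Multiset.mem_map.1 hB
    exact isOnf_app.2 ⟨h₁, h₂, ih h₃ B hB'⟩
  | linear P h ih =>
    intro hA B hB
    obtain ⟨h₁, h₂⟩ := isOnf_linear.1 hA
    rw [consS_singleton_right] at hB
    obtain ⟨B, hB', rfl⟩ := Multiset.mem_map.1 hB
    exact isOnf_linear.2 ⟨ih h₁ B hB', h₂⟩
  | reusable P h ih =>
    intro hA B hB
    rw [Multiset.mem_singleton] at hB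
    exact hB ▸ isOnf_bangSum.2 (isOnf_reusable.1 hA)

/-! ### Leftmost redexes -/

theorem PreExpr.isLam_iff (m : PreExpr .term) : m.IsLam ↔ ∃ L, m.toExpr = Expr.lam L := by
  constructor
  · intro h
    cases m with
    | lam m => exact ⟨m.toExpr, rfl⟩
    | _ => exact h.elim
  · rintro ⟨L, h⟩
    induction L using Quotient.inductionOn with
    | h l => exact (PreExpr.Equiv.isLam (Quotient.exact h)).2 trivial

namespace Expr

variable (M : Term) (P : Bag)

@[simp] theorem leftmost_var (n : ℕ) : (var n).leftmost = ∅ := rfl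

@[simp] theorem leftmost_one : one.leftmost = ∅ := rfl

@[simp] theorem leftmost_lam :
    (lam M).leftmost = (fun o : Occ .term => (Ctx.lam o.1, o.2)) '' M.leftmost := by
  induction M using Quotient.inductionOn; rfl

theorem leftmost_redex : (app (lam M) P).leftmost = {(Ctx.hole, app (lam M) P)} := by
  induction M using Quotient.inductionOn
  induction P using Quotient.inductionOn
  exact if_pos trivial

variable {M} in
theorem leftmost_appL (h : ∀ L, M ≠ lam L) (h' : M.leftmost ≠ ∅) :
    (app M P).leftmost = (fun o : Occ .term => (Ctx.appL o.1 P, o.2)) '' M.leftmost := by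
  induction M using Quotient.inductionOn with
  | h m =>
    induction P using Quotient.inductionOn
    refine (if_neg ?_).trans (if_pos h')
    rw [PreExpr.isLam_iff]
    exact fun ⟨L, e⟩ => h L e

variable {M} in
theorem leftmost_appR (h : ∀ L, M ≠ lam L) (h' : M.leftmost = ∅) :
    (app M P).leftmost = (fun o : Occ .bag => (Ctx.appR M o.1, o.2)) '' P.leftmost := by
  induction M using Quotient.inductionOn with
  | h m =>
    induction P using Quotient.inductionOn
    refine (if_neg ?_).trans (if_neg (not_not.2 h'))
    rw [PreExpr.isLam_iff]
    exact fun ⟨L, e⟩ => h L e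

@[simp] theorem leftmost_linear : (cons .linear M P).leftmost =
    (fun o : Occ .term => (Ctx.bag .linear o.1 P, o.2)) '' M.leftmost ∪
      (fun o : Occ .bag => (o.1.consTail .linear M, o.2)) '' P.leftmost := by
  induction M using Quotient.inductionOn; induction P using Quotient.inductionOn; rfl

@[simp] theorem leftmost_reusable : (cons .reusable M P).leftmost =
    (fun o : Occ .bag => (o.1.consTail .reusable M, o.2)) '' P.leftmost := by
  induction M using Quotient.inductionOn; induction P using Quotient.inductionOn; rfl

end Expr

theorem IsOnf.leftmost_eq_empty {s : Kind} {A : Expr s} : IsOnf A → A.leftmost = ∅ := by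
  induction A using Expr.induction with
  | var n => simp
  | lam M ih => intro h; simp [ih (isOnf_lam.1 h)]
  | app M P ih ih' =>
    intro h
    obtain ⟨h₁, h₂, h₃⟩ := isOnf_app.1 h
    simp [Expr.leftmost_appR P h₁ (ih h₂), ih' h₃]
  | one => simp
  | cons r M P ih ih' =>
    intro h
    cases r
    · obtain ⟨h₁, h₂⟩ := isOnf_linear.1 h
      simp [ih h₁, ih' h₂]
    · simp [ih' (isOnf_reusable.1 h)]

theorem IsOnf.nonLmStep_star {s : Kind} {A B : Expr s} (hA : IsOnf A)
    (h : ReflTransGen NDStep A B) : ReflTransGen NonLmStep A B := by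
  suffices ReflTransGen NonLmStep A B ∧ IsOnf B from this.1
  induction h with
  | refl => exact ⟨.refl, hA⟩
  | tail _ h ih =>
    obtain ⟨ih, hB⟩ := ih
    obtain ⟨T, hT, hC⟩ := ndStep_iff.1 h
    obtain ⟨o, ho⟩ := h
    exact ⟨ih.tail ⟨o, ho, by simp [hB.leftmost_eq_empty]⟩, hB.giantStep hT _ hC⟩

/-! ### Leftmost steps -/

theorem LmStep.ndStep {s : Kind} {A B : Expr s} (h : LmStep A B) : NDStep A B :=
  let ⟨o, h, _⟩ := h
  ⟨o, h⟩

theorem lmStep_iff {s : Kind} {A B : Expr s} : LmStep A B ↔ ∃ C R S, C.IsLinear ∧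
    (C, R) ∈ A.leftmost ∧ A = C.fill R ∧ RootGiant R S ∧ B ∈ C.fillSum S := by
  constructor
  · rintro ⟨⟨C, R⟩, ⟨T, U, ⟨hA, S, hS, rfl⟩, hB⟩, hC, h⟩
    exact ⟨C, R, S, hC, h, hA, hS, by simp [hB]⟩
  · rintro ⟨C, R, S, hC, h, hA, hS, hB⟩
    obtain ⟨U, hU⟩ := Multiset.exists_cons_of_mem hB
    exact ⟨(C, R), ⟨_, U, ⟨hA, S, hS, rfl⟩, by rw [hU, Multiset.singleton_add]⟩, hC, h⟩

theorem lmStep_redex_iff {M K : Term} {P : Bag} :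
    LmStep (Expr.app (Expr.lam M) P) K ↔ K ∈ giantS P {M} := by
  rw [lmStep_iff]
  constructor
  · rintro ⟨C, R, S, -, h, -, hS, hK⟩
    rw [Expr.leftmost_redex, Set.mem_singleton_iff, Prod.mk.injEq] at h
    obtain ⟨rfl, rfl⟩ := h
    obtain ⟨M', P', e, rfl⟩ := rootGiant_iff.1 hS
    simp only [Expr.app_inj, Expr.lam_inj] at e
    obtain ⟨rfl, rfl⟩ := e
    exact hK
  · intro h
    exact ⟨.hole, _, _, trivial, by rw [Expr.leftmost_redex]; rfl, rfl,
      rootGiant_iff.2 ⟨M, P, rfl, rfl⟩, h⟩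

namespace LmStep

theorem lam {M M' : Term} (h : LmStep M M') : LmStep (Expr.lam M) (Expr.lam M') := by
  obtain ⟨C, R, S, hC, h, rfl, hS, hM⟩ := lmStep_iff.1 h
  exact lmStep_iff.2 ⟨.lam C, R, S, hC, by rw [Expr.leftmost_lam]; exact ⟨_, h, rfl⟩, rfl, hS,
    Multiset.mem_map_of_mem _ hM⟩

theorem appL {M M' : Term} (h : LmStep M M') (hM : ∀ L, M ≠ Expr.lam L) (P : Bag) :
    LmStep (Expr.app M P) (Expr.app M' P) := by
  obtain ⟨C, R, S, hC, h, rfl, hS, hM'⟩ := lmStep_iff.1 h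
  refine lmStep_iff.2 ⟨.appL C P, R, S, hC, ?_, rfl, hS, Multiset.mem_map_of_mem _ hM'⟩
  rw [Expr.leftmost_appL P hM (Set.nonempty_iff_ne_empty.1 ⟨_, h⟩)]
  exact ⟨_, h, rfl⟩

theorem of_appL {M K : Term} {P : Bag} (h : LmStep (Expr.app M P) K)
    (hM : ∀ L, M ≠ Expr.lam L) (hM' : M.leftmost ≠ ∅) :
    ∃ M', LmStep M M' ∧ K = Expr.app M' P := by
  obtain ⟨C, R, S, hC, h, e, hS, hK⟩ := lmStep_iff.1 h
  rw [Expr.leftmost_appL P hM hM'] at h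
  obtain ⟨⟨C, R⟩, h', e'⟩ := h
  simp only [Prod.mk.injEq] at e'
  obtain ⟨rfl, rfl⟩ := e'
  obtain ⟨M', hM', rfl⟩ := Multiset.mem_map.1 hK
  exact ⟨M', lmStep_iff.2 ⟨C, R, S, hC, h', (Expr.app_inj.1 e).1, hS, hM'⟩, rfl⟩

theorem appR {M : Term} {P P' : Bag} (h : LmStep P P') (hM : ∀ L, M ≠ Expr.lam L)
    (hM' : M.leftmost = ∅) : LmStep (Expr.app M P) (Expr.app M P') := by
  obtain ⟨C, R, S, hC, h, rfl, hS, hP⟩ := lmStep_iff.1 h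
  refine lmStep_iff.2 ⟨.appR M C, R, S, hC, ?_, rfl, hS, Multiset.mem_map_of_mem _ hP⟩
  rw [Expr.leftmost_appR _ hM hM']
  exact ⟨_, h, rfl⟩

theorem linear {M M' : Term} (h : LmStep M M') (P : Bag) :
    LmStep (Expr.cons .linear M P) (Expr.cons .linear M' P) := by
  obtain ⟨C, R, S, hC, h, rfl, hS, hM⟩ := lmStep_iff.1 h
  refine lmStep_iff.2 ⟨.bag .linear C P, R, S, hC, ?_, rfl, hS, Multiset.mem_map_of_mem _ hM⟩
  rw [Expr.leftmost_linear]
  exact .inl ⟨_, h, rfl⟩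

theorem cons {P P' : Bag} (h : LmStep P P') (r : Mode) (M : Term) :
    LmStep (Expr.cons r M P) (Expr.cons r M P') := by
  obtain ⟨C, R, S, hC, h, rfl, hS, hP⟩ := lmStep_iff.1 h
  refine lmStep_iff.2 ⟨C.consTail r M, R, S, ?_, ?_, ?_, hS, ?_⟩
  · cases C with
    | bag r' C Q => cases r' <;> exact hC
  · cases r
    · rw [Expr.leftmost_linear]; exact .inr ⟨_, h, rfl⟩
    · rw [Expr.leftmost_reusable]; exact ⟨_, h, rfl⟩
  · cases C; exact Expr.cons_swap _ _ _ _ _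
  · cases C with
    | bag r' C Q =>
      cases r'
      · obtain ⟨K, hK, rfl⟩ := Multiset.mem_map.1 hP
        exact Multiset.mem_map.2 ⟨K, hK, Expr.cons_swap _ _ _ _ _⟩
      · exact hC.elim

end LmStep

/-! ### Iterated application -/

@[simp] theorem apps_nil (M : Term) : apps M [] = M := rfl

@[simp] theorem apps_cons (M : Term) (P : Bag) (Ps : List Bag) :
    apps M (P :: Ps) = apps (Expr.app M P) Ps := rfl

theorem apps_concat (M : Term) (P : Bag) (Ps : List Bag) :
    apps M (Ps ++ [P]) = Expr.app (apps M Ps) P := by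
  simp [apps]

theorem apps_app_ne_lam (M : Term) (P : Bag) (Ps : List Bag) (L : Term) :
    apps (Expr.app M P) Ps ≠ Expr.lam L := by
  induction Ps using List.reverseRecOn with
  | nil => simp
  | append_singleton Ps P _ => simp [apps_concat]

theorem IsOnf.of_apps {M : Term} {Ps : List Bag} (h : IsOnf (apps M Ps)) : IsOnf M := by
  induction Ps generalizing M with
  | nil => exact h
  | cons P Ps ih => exact (isOnf_app.1 (ih h)).2.1

theorem LmStep.apps {M M' : Term} (h : LmStep M M') (hM : ∀ L, M ≠ Expr.lam L)
    (Ps : List Bag) : LmStep (apps M Ps) (ResourceCalculus.apps M' Ps) := by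
  induction Ps generalizing M M' with
  | nil => exact h
  | cons P Ps ih => exact ih (h.appL hM P) (by simp)

theorem leftmost_apps_redex (M : Term) (P : Bag) (Ps : List Bag) :
    (apps (Expr.app (Expr.lam M) P) Ps).leftmost ≠ ∅ := by
  induction Ps using List.reverseRecOn with
  | nil => simp [Expr.leftmost_redex]
  | append_singleton Ps Q ih =>
    rw [apps_concat, Expr.leftmost_appL Q (apps_app_ne_lam _ _ _) ih]
    simpa using ih

/-- The left part of every application along the spine contains the head redex, so leftmost
reduction never looks at the arguments `Ps`. -/
theorem lmStep_apps_redex_iff {M K : Term} {P : Bag} {Ps : List Bag} :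
    LmStep (apps (Expr.app (Expr.lam M) P) Ps) K ↔ ∃ R ∈ giantS P {M}, K = apps R Ps := by
  constructor
  · induction Ps using List.reverseRecOn generalizing K with
    | nil => exact fun h => ⟨K, lmStep_redex_iff.1 h, rfl⟩
    | append_singleton Ps Q ih =>
      intro h
      rw [apps_concat] at h
      obtain ⟨K, h', rfl⟩ := h.of_appL (apps_app_ne_lam _ _ _) (leftmost_apps_redex _ _ _)
      obtain ⟨R, hR, rfl⟩ := ih h'
      exact ⟨R, hR, (apps_concat _ _ _).symm⟩
  · rintro ⟨R, hR, rfl⟩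
    exact (lmStep_redex_iff.2 hR).apps (by simp) Ps

theorem WeakHead.exists_apps {M M' : Term} (h : WeakHead M M') : ∃ A P Ps, ∃ R ∈ giantS P {A},
    M = apps (Expr.app (Expr.lam A) P) Ps ∧ M' = apps R Ps := by
  induction h with
  | @beta M R P hR => exact ⟨M, P, [], R, hR, rfl, rfl⟩
  | app Q _ ih =>
    obtain ⟨A, P, Ps, R, hR, rfl, rfl⟩ := ih
    exact ⟨A, P, Ps ++ [Q], R, hR, (apps_concat _ _ _).symm, (apps_concat _ _ _).symm⟩

/-! ### Soundness of the machine -/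

theorem mem_giantS_one {M K : Term} : K ∈ giantS Expr.one {M} ↔ K ∈ M.zeroSubst := by
  rw [giantS, gsub_one, substS_singleton, Expr.zeroSubst_eq]

theorem mem_giantS_cons {M K N : Term} {r : Mode} {P : Bag} :
    K ∈ giantS (Expr.cons r N P) {M} ↔ ∃ M' ∈ M.resSubst 0 r N.shift, K ∈ giantS P {M'} := by
  rw [giantS, gsub_cons, ← bind_resSubst, Multiset.singleton_bind]
  exact mem_giantS

theorem isOnf_apps {M : Term} (hM : ∀ L, M ≠ Expr.lam L) (hM' : IsOnf M) {Ps : List Bag}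
    (h : ∀ P ∈ Ps, IsOnf P) : IsOnf (apps M Ps) := by
  induction Ps generalizing M with
  | nil => exact hM'
  | cons P Ps ih =>
    rw [List.forall_mem_cons] at h
    exact ih (by simp) (isOnf_app.2 ⟨hM, hM', h.1⟩) h.2

theorem star_map {α β : Type*} {r : α → α → Prop} {q : β → β → Prop} (f : α → β)
    (h : ∀ a b, r a b → q (f a) (f b)) {a b : α} (hab : ReflTransGen r a b) :
    ReflTransGen q (f a) (f b) := by
  induction hab with
  | refl => exact .refl
  | tail _ hbc ih => exact ih.tail (h _ _ hbc)

/-- Arguments are reduced from left to right: the leftmost redexes move to the next argument only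
when everything before it is an onf, hence the condition on each `q.2`. -/
theorem lmStep_star_apps {M : Term} (hM : ∀ L, M ≠ Expr.lam L) (hM' : IsOnf M)
    (Qs : List (Bag × Bag)) (h : ∀ q ∈ Qs, ReflTransGen LmStep q.1 q.2 ∧ IsOnf q.2) :
    ReflTransGen LmStep (apps M (Qs.map Prod.fst)) (apps M (Qs.map Prod.snd)) := by
  induction Qs generalizing M with
  | nil => exact .refl
  | cons q Qs ih =>
    rw [List.forall_mem_cons] at h
    refine ReflTransGen.trans (b := apps (Expr.app M q.2) (Qs.map Prod.fst)) ?_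
      (ih (by simp) (isOnf_app.2 ⟨hM, hM', h.1.2⟩) h.2)
    exact star_map (fun P => apps (Expr.app M P) (Qs.map Prod.fst))
      (fun P P' hP => (hP.appR hM hM'.leftmost_eq_empty).apps (by simp) _) h.1.1

theorem lmStep_star_redex {M M' N N' : Term} {r : Mode} {P : Bag} {Ps : List Bag}
    (hM : M' ∈ M.resSubst 0 r N.shift)
    (h : ReflTransGen LmStep (apps (Expr.app (Expr.lam M') P) Ps) N') (hN : IsOnf N') :
    ReflTransGen LmStep (apps (Expr.app (Expr.lam M) (Expr.cons r N P)) Ps) N' := by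
  -- The reduction is not empty, as its start contains a head redex while its end is an onf. Its
  -- first step fires this head redex and is merged with the substitution of `N`.
  rcases h.cases_head with rfl | ⟨K, hK, h⟩
  · exact absurd rfl ((isOnf_app.1 hN.of_apps).1 M')
  · obtain ⟨R, hR, rfl⟩ := lmStep_apps_redex_iff.1 hK
    exact .head (lmStep_apps_redex_iff.2 ⟨R, mem_giantS_cons.2 ⟨M', hM, hR⟩, rfl⟩) h

theorem NDMachine.sound {M N : Term} (h : NDMachine M N) :
    ReflTransGen LmStep M N ∧ IsOnf N := by
  refine NDMachine.rec (motive_1 := fun M N _ => ReflTransGen LmStep M N ∧ IsOnf N)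
    (motive_2 := fun P Q _ => ReflTransGen LmStep P Q ∧ IsOnf Q)
    ?_ ?_ ?_ ?_ ?_ ?_ ?_ ?_ ?_ h
  · exact fun M M' _ ih => ⟨star_map _ (fun _ _ h => h.lam) ih.1, isOnf_lam.2 ih.2⟩
  · exact fun M hM => ⟨.refl, hM⟩
  · intro x Qs _ ih
    refine ⟨lmStep_star_apps (by simp) (isOnf_var x) Qs ih,
      isOnf_apps (by simp) (isOnf_var x) fun P hP => ?_⟩
    obtain ⟨q, hq, rfl⟩ := List.mem_map.1 hP
    exact (ih q hq).2
  · intro M M₀ M' Ps hM _ ih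
    exact ⟨.head (lmStep_apps_redex_iff.2 ⟨M₀, mem_giantS_one.2 (by simp [hM]), rfl⟩) ih.1,
      ih.2⟩
  · intro M N M' M'' P Ps U hM _ ih
    exact ⟨lmStep_star_redex (r := .linear) (by simp [Expr.resSubst, hM]) ih.1 ih.2, ih.2⟩
  · intro M N M' M'' P Ps U hM _ ih
    exact ⟨lmStep_star_redex (r := .reusable) (by simp [Expr.resSubst, hM]) ih.1 ih.2, ih.2⟩
  · exact ⟨.refl, isOnf_one⟩
  · intro M N P P' _ _ ih ih'
    exact ⟨(star_map _ (fun _ _ h => h.linear P) ih.1).trans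
      (star_map _ (fun _ _ h => h.cons .linear N) ih'.1), isOnf_linear.2 ⟨ih.2, ih'.2⟩⟩
  · intro M P P' _ ih
    exact ⟨star_map _ (fun _ _ h => h.cons .reusable M) ih.1, isOnf_reusable.2 ih.2⟩

/-! ### Completeness of the machine -/

theorem card_bind_le_one {α β : Type*} {S : Multiset α} {f : α → Multiset β}
    (hS : S.card ≤ 1) (hf : ∀ a, (f a).card ≤ 1) : (S.bind f).card ≤ 1 := by
  rcases Nat.le_one_iff_eq_zero_or_eq_one.1 hS with h | h
  · simp [Multiset.card_eq_zero.1 h]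
  · obtain ⟨a, rfl⟩ := Multiset.card_eq_one.1 h
    simpa using hf a

theorem Expr.card_subst_le_one {s : Kind} (A : Expr s) : ∀ {σ : ℕ → FormalSum .term},
    (∀ n, (σ n).card ≤ 1) → (A.subst σ).card ≤ 1 := by
  induction A using Expr.induction with
  | var n => exact fun h => h n
  | lam M ih =>
    intro σ h
    rw [subst_lam, lamS, Multiset.card_map]
    refine ih fun n => ?_
    cases n with
    | zero => simp [liftSub]
    | succ n => simpa [liftSub] using h n
  | app M P ih ih' =>
    intro σ h
    rw [subst_app]
    exact card_bind_le_one (ih h) fun M => by simpa using ih' h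
  | one => simp
  | cons r M P ih ih' =>
    intro σ h
    cases r
    · rw [subst_linear]
      exact card_bind_le_one (ih h) fun M => by simpa using ih' h
    · rw [subst_reusable, bangS, Multiset.card_map]
      exact ih' h

/-- The machine's rule for the empty bag asks for a single term, not for a choice of addend. Each
index is replaced by at most one addend, and then no constructor produces more than one. -/
theorem Expr.zeroSubst_eq_singleton {M K : Term} (h : K ∈ M.zeroSubst) : M.zeroSubst = {K} := by
  have : M.zeroSubst.card ≤ 1 := by
    rw [zeroSubst_eq]
    refine card_subst_le_one M fun n => ?_
    cases n <;> simp [zeroSub]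
  obtain ⟨U, hU⟩ := Multiset.exists_cons_of_mem h
  rw [hU, Multiset.card_cons] at this
  rw [hU, Multiset.card_eq_zero.1 (show U.card = 0 by omega)]
  rfl

/-- One giant step is replayed by the machine resource by resource, choosing at each stage the
addend that leads to `R`. -/
theorem NDMachine.apps_redex {Ps : List Bag} {N : Term} (P : Bag) : ∀ {M R : Term},
    R ∈ giantS P {M} → NDMachine (apps R Ps) N →
      NDMachine (apps (Expr.app (Expr.lam M) P) Ps) N := by
  induction P using Expr.bagInduction with
  | one =>
    intro M R hR h
    exact .zero M R N Ps (Expr.zeroSubst_eq_singleton (mem_giantS_one.1 hR)) h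
  | cons r L P ih =>
    intro M R hR h
    obtain ⟨M', hM', hR'⟩ := mem_giantS_cons.1 hR
    obtain ⟨U, hU⟩ := Multiset.exists_cons_of_mem hM'
    rw [← Multiset.singleton_add] at hU
    cases r
    · exact .beta M L M' N P Ps U hU (ih hR' h)
    · exact .bangBeta M L M' N P Ps U hU (ih hR' h)

theorem NDMachine.expand {M M' N : Term} (h : ReflTransGen WeakHead M M')
    (h' : NDMachine M' N) : NDMachine M N := by
  induction h with
  | refl => exact h'
  | tail _ h ih =>
    obtain ⟨A, P, Ps, R, hR, rfl, rfl⟩ := h.exists_apps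
    exact ih (h'.apps_redex P hR)

theorem BMachine.bangSum {P P' : Bag} (h : BMachine P P') (U : FormalSum .term) :
    BMachine (bangSum U P) (ResourceCalculus.bangSum U P') := by
  induction U using Multiset.induction_on with
  | empty => simpa
  | cons a U ih => simpa using BMachine.bang a _ _ ih

-- Closure of nd-steps under constructors, and extraction of machine runs

theorem NDStep.lam {M M' : Term} (h : NDStep M M') : NDStep (Expr.lam M) (Expr.lam M') := by
  obtain ⟨T, h, hM⟩ := ndStep_iff.1 h
  exact ndStep_iff.2 ⟨_, h.lam, Multiset.mem_map_of_mem _ hM⟩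

theorem NDStep.appL {M M' : Term} (h : NDStep M M') (P : Bag) :
    NDStep (Expr.app M P) (Expr.app M' P) := by
  obtain ⟨T, h, hM⟩ := ndStep_iff.1 h
  exact ndStep_iff.2 ⟨_, h.appL P, by simpa [mem_appS] using hM⟩

theorem NDStep.appR {P P' : Bag} (h : NDStep P P') (M : Term) :
    NDStep (Expr.app M P) (Expr.app M P') := by
  obtain ⟨T, h, hP⟩ := ndStep_iff.1 h
  exact ndStep_iff.2 ⟨_, h.appR M, by simpa [mem_appS] using hP⟩

theorem NDStep.linear {M M' : Term} (h : NDStep M M') (P : Bag) :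
    NDStep (Expr.cons .linear M P) (Expr.cons .linear M' P) := by
  obtain ⟨T, h, hM⟩ := ndStep_iff.1 h
  exact ndStep_iff.2 ⟨_, h.linear P, by
    rw [consS_singleton_right]; exact Multiset.mem_map_of_mem _ hM⟩

theorem NDStep.cons {P P' : Bag} (h : NDStep P P') (r : Mode) (M : Term) :
    NDStep (Expr.cons r M P) (Expr.cons r M P') := by
  obtain ⟨T, h, hP⟩ := ndStep_iff.1 h
  exact ndStep_iff.2 ⟨_, h.cons r M, Multiset.mem_map_of_mem _ hP⟩

theorem NDStep.bangSum {P P' : Bag} (h : NDStep P P') (U : FormalSum .term) :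
    NDStep (bangSum U P) (ResourceCalculus.bangSum U P') := by
  obtain ⟨T, h, hP⟩ := ndStep_iff.1 h
  exact ndStep_iff.2 ⟨_, h.bangSum_tail U, Multiset.mem_map_of_mem _ hP⟩

/-- The machine treats all arguments of a head variable in one rule, so a bare run for the function
part of an application is of no use. For targets that are not abstractions the induction therefore
also provides the whole spine `x P₁…P_m`, to which the next argument is appended. -/
theorem Standard.complete {s : Kind} {A B : Expr s} (h : Standard A B) : IsOnf B →
    match s with
    | .term => (∃ N, NDMachine A N ∧ ReflTransGen NDStep N B) ∧ ((∀ L, B ≠ Expr.lam L) →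
        ∃ (x : ℕ) (Qs : List (Bag × Bag)), ReflTransGen WeakHead A (apps (Expr.var x) (Qs.map Prod.fst)) ∧
          (∀ q ∈ Qs, BMachine q.1 q.2) ∧
          ReflTransGen NDStep (apps (Expr.var x) (Qs.map Prod.snd)) B)
    | .bag => ∃ P, BMachine A P ∧ ReflTransGen NDStep P B := by
  induction h with
  | @var M n h =>
    exact fun _ => ⟨⟨_, .expand h (.endRule _ (isOnf_var n)), .refl⟩,
      fun _ => ⟨n, [], h, by simp, .refl⟩⟩
  | lam h _ ih =>
    intro hB
    obtain ⟨⟨N, hN, h'⟩, -⟩ := ih (isOnf_lam.1 hB)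
    exact ⟨⟨_, .expand h (.lam _ _ hN), star_map _ (fun _ _ h => h.lam) h'⟩,
      fun hL => absurd rfl (hL _)⟩
  | @app M A A' P P' h _ _ ih ih' =>
    intro hB
    obtain ⟨h₁, h₂, h₃⟩ := isOnf_app.1 hB
    obtain ⟨x, Qs, hx, hQs, hA⟩ := (ih h₂).2 h₁
    obtain ⟨P'', hP, hP'⟩ := ih' h₃
    have key : ReflTransGen WeakHead M
          (apps (Expr.var x) ((Qs ++ [(P, P'')]).map Prod.fst)) ∧
        (∀ q ∈ Qs ++ [(P, P'')], BMachine q.1 q.2) ∧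
        ReflTransGen NDStep (apps (Expr.var x) ((Qs ++ [(P, P'')]).map Prod.snd))
          (Expr.app A' P') := by
      simp only [List.map_append, List.map_cons, List.map_nil, apps_concat]
      refine ⟨h.trans (weakHead_star_app hx P), ?_, ?_⟩
      · intro q hq
        rcases List.mem_append.1 hq with hq | hq
        · exact hQs q hq
        · rw [List.mem_singleton.1 hq]; exact hP
      · exact (star_map _ (fun _ _ h => h.appL P'') hA).trans
          (star_map _ (fun _ _ h => h.appR A') hP')
    exact ⟨⟨_, .expand key.1 (.head x _ key.2.1), key.2.2⟩, fun _ => ⟨x, _, key⟩⟩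
  | one => exact fun _ => ⟨_, .one, .refl⟩
  | @linear M M' P P' _ _ ih ih' =>
    intro hB
    obtain ⟨h₁, h₂⟩ := isOnf_linear.1 hB
    obtain ⟨⟨N, hN, hN'⟩, -⟩ := ih h₁
    obtain ⟨Q, hQ, hQ'⟩ := ih' h₂
    exact ⟨_, .lin _ _ _ _ hN hQ, (star_map _ (fun _ _ h => h.linear Q) hN').trans
      (star_map _ (fun _ _ h => h.cons .linear M') hQ')⟩
  | @reusable U T P P' f hUT _ _ _ _ ih =>
    intro hB
    obtain ⟨Q, hQ, hQ'⟩ := ih (isOnf_bangSum.1 hB)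
    -- The machine leaves the reusable group `U` untouched; its reduction to `T` is performed after
    -- the run.
    exact ⟨_, hQ.bangSum U, (star_map (q := NDStep) (fun S => bangSum S Q)
      (fun _ _ h => ndStep_iff.2 ⟨_, h.bangSum Q, by simp⟩) hUT).trans
      (star_map _ (fun _ _ h => h.bangSum T) hQ')⟩

end ResourceCalculus

theorem mainTheorem2 :
    (∀ M N : ResourceCalculus.Term, ResourceCalculus.NDMachine M N →
      Relation.ReflTransGen ResourceCalculus.LmStep M N ∧ ResourceCalculus.IsOnf N) ∧
    (∀ M : ResourceCalculus.Term, ResourceCalculus.MayOuterNormalizable M →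
      ∀ N : ResourceCalculus.Term, ResourceCalculus.IsMonf N M →
        ∃ N' : ResourceCalculus.Term, ResourceCalculus.NDMachine M N' ∧
          ResourceCalculus.IsMonf N' M ∧
          Relation.ReflTransGen ResourceCalculus.NonLmStep N' N) := by
  refine ⟨fun M N h => h.sound, fun M _ N ⟨h, hN⟩ => ?_⟩
  obtain ⟨⟨N', hN', h'⟩, -⟩ := (ResourceCalculus.Standard.of_ndStep_star h).complete hN
  obtain ⟨h₁, h₂⟩ := hN'.sound
  exact ⟨N', hN', ⟨ResourceCalculus.star_map id (fun _ _ h => h.ndStep) h₁, h₂⟩,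
    h₂.nonLmStep_star h'⟩
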